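/- **Setting (simultaneous collapse).** Let $\Sigma$ be the one-sorted signature $(\cdot=0,\ \cdot\ge 0;\ \cdot+\cdot,\ \cdot\times\cdot,\ \cdot\vee\cdot,\ -\cdot,\ 0,\ 1)$; $x=y$, $x\ge y$ and $x>y$ abbreviate $x-y=0$, $x-y\ge 0$ and $x-y>0$. *Conventions.* A (finitary) dynamical theory $\mathcal T$ is given by a language and a set of axioms, each of them a dynamical rule $\Gamma\vdash \exists \underline y^1\Delta_1\ \text{or}\ \dots\ \text{or}\ \exists\underline y^m\Delta_m$, where $\Gamma,\Delta_1,\dots,\Delta_m$ are finite lists of atomic formulas. A rule is valid in $\mathcal T$ if it has a dynamical proof: a finite tree with root $\Gamma$, in which one applies instances of axioms whose hypotheses are among the facts already obtained, opens one branch for each alternative of the conclusion (with fresh parameters for the $\underline y^i$), and has at each leaf all the formulas of some $\Delta_i(\underline t)$, for suitable terms $\underline t$, among the facts. If $G$ is a set of generators and $R$ a set of closed atomic formulas of the language enlarged by constants for the elements of $G$, the dynamical algebraic structure $((G,R),\mathcal T)$ is obtained by adding the elements of $G$ as constants and those of $R$ as axioms. For the theories below it *collapses* if $1=0$ is valid in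 it. A theory $\mathcal T'$ extends $\mathcal T$ if its language contains that of $\mathcal T$ and the axioms of $\mathcal T$ are valid in $\mathcal T'$; the extension is conservative if each rule in the language of $\mathcal T$ that is valid in $\mathcal T'$ is valid in $\mathcal T$. *The theories.* Both include the axioms of equality and those of commutative rings. * $\mathcal{A}fr$ (strongly lattice-ordered rings, i.e. $f$-rings), on $\Sigma$: moreover $\vee$ is idempotent, commutative and associative, $x+(y\vee z)=(x+y)\vee(x+z)$, $x^+(y\vee z)=(x^+y)\vee(x^+z)$ with $x^+=x\vee 0$, and $x\ge 0$ is defined by $x\vee 0=x$. * $\mathcal{C}rcdsup$ (discrete real closed fields with sup), on $\Sigma$ enlarged by the predicate $\cdot>0$: moreover * $x=0\vdash x\ge 0$; $\ x\ge0,y\ge0\vdash x+y\ge0$; $\ \vdash x^2\ge 0$; $\ x\ge0,y\ge0\vdash xy\ge0$; * $\vdash 1>0$; $\ x>0\vdash x\ge0$; $\ x>0,y\ge0\vdash x+y>0$; $\ x>0,y>0\vdash xy>0$; $\ 0>0\vdash 1=0$; * $x\ge0,x\le0\vdash x=0$; $\ xy=1\vdash x^2>0$; $\ x>0\vdash\exists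 y\ xy=1$; $\ \vdash x\ge0\text{ or }x\le0$; $\ \vdash x=0\text{ or }x^2>0$; * for each $n\in\mathbb N$, with $P(x)=\sum_{k=0}^n a_kx^k$: $\ a<b,\ P(a)P(b)<0\vdash\exists x\,(P(x)=0,\ a<x<b)$; * $\vdash x\vee y\ge x$; $\ \vdash x\vee y\ge y$; $\ z\ge x,z\ge y\vdash z\ge x\vee y$. A theory $\mathcal T$ is *intermediate* if it extends $\mathcal{A}fr$ and if $\mathcal{C}rcdsup$, or some conservative (one-sorted) extension of $\mathcal{C}rcdsup$, extends $\mathcal T$. **Theorem.** $\mathcal{C}rcdsup$ extends $\mathcal{A}fr$, and the theories $\mathcal{A}fr$, $\mathcal{C}rcdsup$ and all the intermediate theories collapse simultaneously: for each presentation $(G,R)$ on the signature $\Sigma$ (with $G$ and $R$ arbitrary sets) and each intermediate theory $\mathcal T$, if one of the dynamical algebraic structures $((G,R),\mathcal{A}fr)$, $((G,R),\mathcal T)$, $((G,R),\mathcal{C}rcdsup)$ collapses, then so do the two others. -/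

import Mathlib

open scoped FirstOrder

universe u v u' v' w

namespace Dynamical

open FirstOrder.Language (Term)

/-! ## Dynamical theories (finitary, one sort)

Languages, terms and language morphisms are Mathlib's. Nothing is built in about equality: it is one
of the predicates of the language and is governed by axioms. -/

/-- An atomic formula `P(t₁, …, tₙ)` with variables (or generators) in `α`. -/
structure Atom (L : FirstOrder.Language.{u, v}) (α : Type w) where
  arity : ℕ
  rel : L.Relations arity
  args : Fin arity → L.Term α

namespace Atom

variable {L : FirstOrder.Language.{u, v}} {L' : FirstOrder.Language.{u', v'}} {α : Type*} {β : Type*}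

/-- Substitution of terms for the variables. -/
def subst (A : Atom L α) (σ : α → L.Term β) : Atom L β :=
  ⟨A.arity, A.rel, fun i => (A.args i).subst σ⟩

/-- Renaming of the variables. -/
def relabel (g : α → β) (A : Atom L α) : Atom L β :=
  ⟨A.arity, A.rel, fun i => (A.args i).relabel g⟩

/-- Translation along a morphism of languages. -/
def onAtom (φ : L →ᴸ L') (A : Atom L α) : Atom L' α :=
  ⟨A.arity, φ.onRelation A.rel, fun i => φ.onTerm (A.args i)⟩

end Atom

/-- `∃ y₁ … yₖ, Δ`, where `Δ` is a finite list of atomic formulas whose variables are the elements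
of `α` and the `k` bound variables. -/
structure Alternative (L : FirstOrder.Language.{u, v}) (α : Type w) where
  bound : ℕ
  atoms : List (Atom L (α ⊕ Fin bound))

namespace Alternative

variable {L : FirstOrder.Language.{u, v}} {L' : FirstOrder.Language.{u', v'}} {α : Type*} {β : Type*}

/-- Renaming of the free variables. -/
abbrev relabel (g : α → β) (d : Alternative L α) : Alternative L β :=
  ⟨d.bound, d.atoms.map (Atom.relabel (Sum.map g id))⟩

/-- Translation along a morphism of languages. -/
abbrev onAlternative (φ : L →ᴸ L') (d : Alternative L α) : Alternative L' α :=
  ⟨d.bound, d.atoms.map (Atom.onAtom φ)⟩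

end Alternative

/-- A dynamical rule `Γ ⊢ ∃ y¹ Δ₁ or … or ∃ yᵐ Δₘ` in the free variables `x₀, …, xₙ₋₁`.
The empty disjunction (`m = 0`) is falsity. -/
structure Rule (L : FirstOrder.Language.{u, v}) where
  vars : ℕ
  hyps : List (Atom L (Fin vars))
  concl : List (Alternative L (Fin vars))

/-- Translation of a rule along a morphism of languages. -/
abbrev Rule.onRule {L : FirstOrder.Language.{u, v}} {L' : FirstOrder.Language.{u', v'}} (φ : L →ᴸ L') (r : Rule L) :
    Rule L' :=
  ⟨r.vars, r.hyps.map (Atom.onAtom φ), r.concl.map (Alternative.onAlternative φ)⟩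

/-- A dynamical theory on the language `L`, given by its axioms, which are dynamical rules. -/
abbrev DynTheory (L : FirstOrder.Language.{u, v}) := Set (Rule L)

/-- Dynamical proofs, i.e. tree-like computations. `Derives T α Γ D` says that, starting at the root
with the parameters `α` and the facts `Γ`, a finite tree obtained by applying axioms of `T` has the
conclusion `D` (a disjunction) validated at each leaf.

* `leaf`: one of the alternatives `∃ y Δ` of `D` is validated, as `Δ(t)` is among the available facts
  for suitable terms `t`.
* `node`: an axiom of `T`, in which terms `σ` have been substituted for the free variables and whose
  hypotheses are then among the available facts, opens one branch for each alternative `∃ y Δ` of its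
  conclusion; in that branch fresh parameters are added for the `y`, and the facts `Δ` are added. -/
inductive Derives {L : FirstOrder.Language.{u, v}} (T : DynTheory L) :
    (α : Type w) → Set (Atom L α) → List (Alternative L α) → Prop
  | leaf {α : Type w} {Γ : Set (Atom L α)} {D : List (Alternative L α)}
      (d : Alternative L α) (hd : d ∈ D) (t : Fin d.bound → L.Term α)
      (h : ∀ A ∈ d.atoms, A.subst (Sum.elim Term.var t) ∈ Γ) :
      Derives T α Γ D
  | node {α : Type w} {Γ : Set (Atom L α)} {D : List (Alternative L α)}
      (r : Rule L) (hr : r ∈ T) (σ : Fin r.vars → L.Term α)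
      (hyps : ∀ A ∈ r.hyps, A.subst σ ∈ Γ)
      (branches : ∀ d ∈ r.concl,
        Derives T (α ⊕ Fin d.bound)
          (Atom.relabel Sum.inl '' Γ ∪
            {B | ∃ A ∈ d.atoms, B = A.subst
              (Sum.elim (fun i => (σ i).relabel Sum.inl) (fun j => Term.var (Sum.inr j)))})
          (D.map (Alternative.relabel Sum.inl))) :
      Derives T α Γ D

/-- The rule `r` is valid (provable) in the theory `T`. -/
def Valid {L : FirstOrder.Language.{u, v}} (T : DynTheory L) (r : Rule L) : Prop :=
  Derives T (Fin r.vars) {A | A ∈ r.hyps} r.concl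

/-- The fact `A` is valid in the dynamical algebraic structure `((G, R), T)` with generators `G` and
relations `R`: these are closed atomic formulas of the language `L ∪ G`, that is, atomic formulas
whose terms are built on `L` and the elements of `G`. A proof may use any of the relations. -/
def FactValid {L : FirstOrder.Language.{u, v}} (T : DynTheory L) (G : Type w) (R : Set (Atom L G))
    (A : Atom L G) : Prop :=
  Derives T G R [⟨0, [A.relabel Sum.inl]⟩]

/-- `T'` extends `T` (along `φ`): the axioms of `T` are valid in `T'`. -/
def Extends {L : FirstOrder.Language.{u, v}} {L' : FirstOrder.Language.{u', v'}} (φ : L →ᴸ L')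
    (T : DynTheory L) (T' : DynTheory L') : Prop :=
  ∀ r ∈ T, Valid T' (r.onRule φ)

/-- `T'` is a conservative extension of `T` (along `φ`). -/
def ConservativeExtension {L : FirstOrder.Language.{u, v}} {L' : FirstOrder.Language.{u', v'}} (φ : L →ᴸ L')
    (T : DynTheory L) (T' : DynTheory L') : Prop :=
  Extends φ T T' ∧ ∀ r : Rule L, Valid T' (r.onRule φ) → Valid T r

/-! ## The signatures -/

/-- Function symbols `0, 1, -·, · + ·, · × ·, · ∨ ·`. -/
inductive FuncSym : ℕ → Type
  | zero : FuncSym 0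
  | one : FuncSym 0
  | neg : FuncSym 1
  | add : FuncSym 2
  | mul : FuncSym 2
  | sup : FuncSym 2

/-- Predicates `· = 0` and `· ≥ 0`, and moreover `· > 0` if the flag is `true`. -/
inductive RelSym : Bool → ℕ → Type
  | eqZero (b : Bool) : RelSym b 1
  | nonneg (b : Bool) : RelSym b 1
  | pos : RelSym true 1

/-- `latLang false` is the signature `(· = 0, · ≥ 0; +, ×, ∨, -, 0, 1)`;
`latLang true` is `(· = 0, · ≥ 0, · > 0; +, ×, ∨, -, 0, 1)`. -/
abbrev latLang (b : Bool) : FirstOrder.Language.{0, 0} := ⟨FuncSym, RelSym b⟩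

/-- The signature `(· = 0, · ≥ 0; +, ×, ∨, -, 0, 1)`. -/
abbrev Sig : FirstOrder.Language.{0, 0} := latLang false

/-- The signature `(· = 0, · ≥ 0, · > 0; +, ×, ∨, -, 0, 1)`. -/
abbrev SigPos : FirstOrder.Language.{0, 0} := latLang true

/-- The inclusion of the first signature into the second one. -/
def sigIncl : Sig →ᴸ SigPos where
  onFunction := fun _ f => f
  onRelation := fun _ R => match R with
    | .eqZero _ => .eqZero true
    | .nonneg _ => .nonneg true

section Terms

variable {b : Bool} {α : Type*}

instance : Zero ((latLang b).Term α) := ⟨Term.func (FuncSym.zero : (latLang b).Functions 0) ![]⟩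
instance : One ((latLang b).Term α) := ⟨Term.func (FuncSym.one : (latLang b).Functions 0) ![]⟩
instance : Neg ((latLang b).Term α) := ⟨fun s => Term.func FuncSym.neg ![s]⟩
instance : Add ((latLang b).Term α) := ⟨fun s t => Term.func FuncSym.add ![s, t]⟩
instance : Mul ((latLang b).Term α) := ⟨fun s t => Term.func FuncSym.mul ![s, t]⟩
instance : Max ((latLang b).Term α) := ⟨fun s t => Term.func FuncSym.sup ![s, t]⟩
/-- `s - t` abbreviates `s + (-t)`. -/
instance : Sub ((latLang b).Term α) := ⟨fun s t => s + -t⟩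

/-- The atomic formula `t = 0`. -/
def isZero (t : (latLang b).Term α) : Atom (latLang b) α := ⟨1, RelSym.eqZero b, ![t]⟩

/-- The atomic formula `t ≥ 0`. -/
def isNonneg (t : (latLang b).Term α) : Atom (latLang b) α := ⟨1, RelSym.nonneg b, ![t]⟩

/-- The atomic formula `t > 0`. -/
def isPos (t : SigPos.Term α) : Atom SigPos α := ⟨1, RelSym.pos, ![t]⟩

/-- `s = t` abbreviates `s - t = 0`. -/
def eqTm (s t : (latLang b).Term α) : Atom (latLang b) α := isZero (s - t)

/-- `s ≥ t` abbreviates `s - t ≥ 0`. -/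
def geTm (s t : (latLang b).Term α) : Atom (latLang b) α := isNonneg (s - t)

/-- `s > t` abbreviates `s - t > 0`. -/
def gtTm (s t : SigPos.Term α) : Atom SigPos α := isPos (s - t)

/-- `xᵏ`. -/
def powTm (x : (latLang b).Term α) : ℕ → (latLang b).Term α
  | 0 => 1
  | k + 1 => powTm x k * x

/-- `∑_{k ≤ n} aₖ xᵏ`. -/
def polyTm {n : ℕ} (a : Fin (n + 1) → (latLang b).Term α) (x : (latLang b).Term α) :
    (latLang b).Term α :=
  (List.ofFn fun k : Fin (n + 1) => a k * powTm x k).sum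

end Terms

section Rules

variable {b : Bool}

/-- The algebraic rule `Γ ⊢ A`. -/
abbrev algRule (n : ℕ) (p : List (Atom (latLang b) (Fin n)) × Atom (latLang b) (Fin n)) :
    Rule (latLang b) :=
  ⟨n, p.1, [⟨0, [p.2.relabel Sum.inl]⟩]⟩

/-- Algebraic rule without variables. -/
abbrev alg₀ (A : Atom (latLang b) (Fin 0)) : Rule (latLang b) := algRule 0 ([], A)

/-- Algebraic rule in the variable `x`. -/
abbrev alg₁ (f : (latLang b).Term (Fin 1) →
    List (Atom (latLang b) (Fin 1)) × Atom (latLang b) (Fin 1)) : Rule (latLang b) :=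
  algRule 1 (f (Term.var 0))

/-- Algebraic rule in the variables `x, y`. -/
abbrev alg₂ (f : (latLang b).Term (Fin 2) → (latLang b).Term (Fin 2) →
    List (Atom (latLang b) (Fin 2)) × Atom (latLang b) (Fin 2)) : Rule (latLang b) :=
  algRule 2 (f (Term.var 0) (Term.var 1))

/-- Algebraic rule in the variables `x, y, z`. -/
abbrev alg₃ (f : (latLang b).Term (Fin 3) → (latLang b).Term (Fin 3) → (latLang b).Term (Fin 3) →
    List (Atom (latLang b) (Fin 3)) × Atom (latLang b) (Fin 3)) : Rule (latLang b) :=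
  algRule 3 (f (Term.var 0) (Term.var 1) (Term.var 2))

/-- The rule `⊢ A₁ or … or Aₘ` in the variable `x`. -/
abbrev disj₁ (f : (latLang b).Term (Fin 1) → List (Atom (latLang b) (Fin 1))) : Rule (latLang b) :=
  ⟨1, [], (f (Term.var 0)).map fun A => ⟨0, [A.relabel Sum.inl]⟩⟩

/-! ## The axioms -/

/-- Equality axioms: `x = y` (that is, `x - y = 0`) is an equivalence relation which is compatible
with the operations and with the predicates `· = 0` and `· ≥ 0`. -/
def equalityAxioms (b : Bool) : DynTheory (latLang b) :=
  { alg₁ fun x => ([], eqTm x x),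
    alg₂ fun x y => ([eqTm x y], eqTm y x),
    alg₃ fun x y z => ([eqTm x y, eqTm y z], eqTm x z),
    alg₂ fun x y => ([eqTm x y], eqTm (-x) (-y)),
    alg₃ fun x y z => ([eqTm x y], eqTm (x + z) (y + z)),
    alg₃ fun x y z => ([eqTm x y], eqTm (x * z) (y * z)),
    alg₃ fun x y z => ([eqTm x y], eqTm (x ⊔ z) (y ⊔ z)),
    alg₃ fun x y z => ([eqTm x y], eqTm (z ⊔ x) (z ⊔ y)),
    alg₂ fun x y => ([eqTm x y, isZero x], isZero y),
    alg₂ fun x y => ([eqTm x y, isNonneg x], isNonneg y) }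

/-- Axioms of commutative rings: the identities of commutative rings, and the rules which say that
the elements that are `= 0` form an ideal. -/
def ringAxioms (b : Bool) : DynTheory (latLang b) :=
  { alg₂ fun x y => ([], eqTm (x + y) (y + x)),
    alg₃ fun x y z => ([], eqTm ((x + y) + z) (x + (y + z))),
    alg₁ fun x => ([], eqTm (x + 0) x),
    alg₁ fun x => ([], eqTm (x + -x) 0),
    alg₂ fun x y => ([], eqTm (x * y) (y * x)),
    alg₃ fun x y z => ([], eqTm ((x * y) * z) (x * (y * z))),
    alg₁ fun x => ([], eqTm (x * 1) x),
    alg₃ fun x y z => ([], eqTm (x * (y + z)) (x * y + x * z)),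
    alg₀ (isZero 0),
    alg₂ fun x y => ([isZero x, isZero y], isZero (x + y)),
    alg₂ fun x y => ([isZero x], isZero (x * y)) }

/-- **Afr**, the theory of strongly lattice-ordered (commutative, unital) rings, i.e. `f`-rings, on
the signature `(· = 0, · ≥ 0; +, ×, ∨, -, 0, 1)`: commutative rings, with `∨` a commutative,
associative, idempotent law such that translations preserve `∨`, and
`x⁺ (y ∨ z) = x⁺ y ∨ x⁺ z` where `x⁺ = x ∨ 0`; the predicate `x ≥ 0` is defined by `x ∨ 0 = x`. -/
def Afr : DynTheory Sig :=
  equalityAxioms false ∪ ringAxioms false ∪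
  { alg₁ fun x => ([], eqTm (x ⊔ x) x),
    alg₂ fun x y => ([], eqTm (x ⊔ y) (y ⊔ x)),
    alg₃ fun x y z => ([], eqTm ((x ⊔ y) ⊔ z) (x ⊔ (y ⊔ z))),
    alg₃ fun x y z => ([], eqTm (x + (y ⊔ z)) ((x + y) ⊔ (x + z))),
    alg₃ fun x y z => ([], eqTm ((x ⊔ 0) * (y ⊔ z)) (((x ⊔ 0) * y) ⊔ ((x ⊔ 0) * z))),
    alg₁ fun x => ([isNonneg x], eqTm (x ⊔ 0) x),
    alg₁ fun x => ([eqTm (x ⊔ 0) x], isNonneg x) }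

/-- Axioms of the theory of discrete ordered fields, apart from those of commutative rings. In this
order:
`x = 0 ⊢ x ≥ 0`; `x ≥ 0, y ≥ 0 ⊢ x + y ≥ 0`; `⊢ x² ≥ 0`; `x ≥ 0, y ≥ 0 ⊢ xy ≥ 0`;
`⊢ 1 > 0`; `x > 0 ⊢ x ≥ 0`; `x > 0, y ≥ 0 ⊢ x + y > 0`; `x > 0, y > 0 ⊢ xy > 0`;
compatibility of `> 0` with equality; collapse `0 > 0 ⊢ 1 = 0`;
`x ≥ 0, x ≤ 0 ⊢ x = 0`; `xy = 1 ⊢ x² > 0`; `x > 0 ⊢ ∃ y, xy = 1`; `⊢ x ≥ 0 or x ≤ 0`;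
`⊢ x = 0 or x² > 0`. Here `x ≤ 0` stands for `0 - x ≥ 0`. -/
def orderedFieldAxioms : DynTheory SigPos :=
  { alg₁ fun x => ([isZero x], isNonneg x),
    alg₂ fun x y => ([isNonneg x, isNonneg y], isNonneg (x + y)),
    alg₁ fun x => ([], isNonneg (x * x)),
    alg₂ fun x y => ([isNonneg x, isNonneg y], isNonneg (x * y)),
    alg₀ (isPos 1),
    alg₁ fun x => ([isPos x], isNonneg x),
    alg₂ fun x y => ([isPos x, isNonneg y], isPos (x + y)),
    alg₂ fun x y => ([isPos x, isPos y], isPos (x * y)),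
    alg₂ fun x y => ([eqTm x y, isPos x], isPos y),
    algRule 0 ([isPos 0], eqTm 1 0),
    alg₁ fun x => ([isNonneg x, geTm 0 x], isZero x),
    alg₂ fun x y => ([eqTm (x * y) 1], isPos (x * x)),
    ⟨1, [isPos (Term.var 0)],
      [⟨1, [eqTm (Term.var (Sum.inl 0) * Term.var (Sum.inr 0)) 1]⟩]⟩,
    disj₁ fun x => [isNonneg x, geTm 0 x],
    disj₁ fun x => [isZero x, isPos (x * x)] }

/-- **RCF**ₙ: `a < b, P(a) P(b) < 0 ⊢ ∃ x (P(x) = 0, a < x < b)` where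
`P(x) = ∑_{k ≤ n} aₖ xᵏ`. The free variables are `a₀, …, aₙ, a, b`, in this order. -/
abbrev rcfAxiom (n : ℕ) : Rule SigPos :=
  let coeff : Fin (n + 1) → Fin (n + 1 + 2) := Fin.castAdd 2
  let a : Fin (n + 1 + 2) := Fin.natAdd (n + 1) 0
  let b : Fin (n + 1 + 2) := Fin.natAdd (n + 1) 1
  let P : SigPos.Term (Fin (n + 1 + 2)) → SigPos.Term (Fin (n + 1 + 2)) :=
    polyTm fun k => Term.var (coeff k)
  let P' : SigPos.Term (Fin (n + 1 + 2) ⊕ Fin 1) → SigPos.Term (Fin (n + 1 + 2) ⊕ Fin 1) :=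
    polyTm fun k => Term.var (Sum.inl (coeff k))
  let x : SigPos.Term (Fin (n + 1 + 2) ⊕ Fin 1) := Term.var (Sum.inr 0)
  ⟨n + 1 + 2,
    [gtTm (Term.var b) (Term.var a), gtTm 0 (P (Term.var a) * P (Term.var b))],
    [⟨1, [isZero (P' x), gtTm x (Term.var (Sum.inl a)), gtTm (Term.var (Sum.inl b)) x]⟩]⟩

/-- **Crcdsup**, the theory of discrete real closed fields with sup: the theory of discrete ordered
fields, the axioms **RCF**ₙ, and the three axioms `⊢ x ∨ y ≥ x`, `⊢ x ∨ y ≥ y`,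
`z ≥ x, z ≥ y ⊢ z ≥ x ∨ y`. -/
def Crcdsup : DynTheory SigPos :=
  equalityAxioms true ∪ ringAxioms true ∪ orderedFieldAxioms ∪ Set.range rcfAxiom ∪
  { alg₂ fun x y => ([], geTm (x ⊔ y) x),
    alg₂ fun x y => ([], geTm (x ⊔ y) y),
    alg₃ fun x y z => ([geTm z x, geTm z y], geTm z (x ⊔ y)) }

end Rules

/-! ## Collapse -/

/-- Let `T` be a theory on a language `L` that contains (through `ι`) the signature
`(· = 0, · ≥ 0; +, ×, ∨, -, 0, 1)`, and `(G, R)` a presentation on this signature. The dynamical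
algebraic structure `((G, R), T)` collapses: the fact `1 = 0` is valid in it. -/
def Collapses {L : FirstOrder.Language.{u, v}} (ι : Sig →ᴸ L) (T : DynTheory L) (G : Type w)
    (R : Set (Atom Sig G)) : Prop :=
  FactValid T G (Atom.onAtom ι '' R) ((eqTm 1 0 : Atom Sig G).onAtom ι)

/-- The theories `T₁` and `T₂` collapse simultaneously on the signature
`(· = 0, · ≥ 0; +, ×, ∨, -, 0, 1)`: for each presentation `(G, R)` on this signature,
`((G, R), T₁)` collapses if and only if `((G, R), T₂)` does. -/
def CollapseSimultaneously {L₁ : FirstOrder.Language.{u, v}} {L₂ : FirstOrder.Language.{u', v'}}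
    (ι₁ : Sig →ᴸ L₁) (T₁ : DynTheory L₁) (ι₂ : Sig →ᴸ L₂) (T₂ : DynTheory L₂) : Prop :=
  ∀ (G : Type w) (R : Set (Atom Sig G)), Collapses ι₁ T₁ G R ↔ Collapses ι₂ T₂ G R

/-- `T` is intermediate between **Afr** and **Crcdsup**: it extends **Afr**, and **Crcdsup**, possibly
after a conservative extension (for instance by function symbols for things whose unique existence
is provable), extends `T`. Taking **Crcdsup** itself as the conservative extension gives the theories
`T` on a language contained in that of **Crcdsup** with `Afr ≤ T ≤ Crcdsup`. -/
def IsIntermediate {L : FirstOrder.Language.{u, v}} (ι : Sig →ᴸ L) (T : DynTheory L) : Prop :=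
  Extends ι Afr T ∧
  ∃ (L' : FirstOrder.Language.{u', v'}) (U : DynTheory L') (j : L →ᴸ L') (k : SigPos →ᴸ L'),
    j.comp ι = k.comp sigIncl ∧ Extends j T U ∧ ConservativeExtension k Crcdsup U

end Dynamical

/-! Collapse passes upwards along extensions: in a dynamical proof every use of an axiom is replaced
by a proof of it in the larger theory, and the pieces are grafted together (`Derives.cut`,
`Derives.translate`). It passes down a conservative extension because a proof uses finitely many
relations, hence finitely many generators, and so amounts to the validity of one rule
(`ConservativeExtension.factValid`). What remains is that a collapse in `Crcdsup` forces one in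
`Afr`; this is proved by contraposition, through ordered fields.

Suppose that `((G, R), Afr)` does not collapse. The terms modulo provable equality form a nontrivial
f-ring. Its nonnegative elements form a preordering, and positive and negative parts are orthogonal:
x⁺ x⁻ = 0. A maximal preordering containing this one is an ordering with prime support, and the
fraction field of the quotient by the support is a linearly ordered field `K`. In a field x⁺ x⁻ = 0
kills one of the two factors, so the map to `K` preserves suprema (`exists_ringHom_map_sup`). Hence
the relations `R` have a solution in `K`.

Such a solution excludes a collapse in `Crcdsup` (`not_factValid_Crcdsup`). Follow a branch of the
alleged proof while keeping all its facts true in an ordered field. Every axiom holds in the current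
field, except perhaps the intermediate value axioms, for which one root is adjoined
(`exists_orderedField_root`). The branch then ends at a leaf where 1 = 0 would be true. No real
closure is needed, since a proof tree is well founded and each step asks for one extension only.

The root is adjoined by the same construction of ordered fields, applied to a preordering of `K[X]`.
That this preordering omits -1 is shown by a descent on degrees (`not_dvd_one_add_sumSq`).

Finally, `Crcdsup` extends `Afr` by computations in its own term ring, with one case distinction for
the product axiom (`factValid_mul_sup`). -/

namespace Dynamical

open FirstOrder FirstOrder.Language

/-! ## Substitution -/

section Subst

variable {L : FirstOrder.Language.{u, v}} {L' : FirstOrder.Language.{u', v'}}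
  {α : Type*} {β : Type*} {γ : Type*}

theorem term_subst_subst (t : L.Term α) (σ : α → L.Term β) (τ : β → L.Term γ) :
    (t.subst σ).subst τ = t.subst fun a => (σ a).subst τ := by
  induction t with
  | var => rfl
  | func f ts ih => simp only [Term.subst, ih]

theorem term_subst_var (t : L.Term α) : t.subst Term.var = t := by
  induction t with
  | var => rfl
  | func f ts ih => simp only [Term.subst, ih]

theorem term_relabel_eq_subst (g : α → β) (t : L.Term α) :
    t.relabel g = t.subst fun a => Term.var (g a) := by
  induction t with
  | var => rfl
  | func f ts ih => simp only [Term.subst, Term.relabel, ih]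

theorem onTerm_subst (φ : L →ᴸ L') (t : L.Term α) (σ : α → L.Term β) :
    φ.onTerm (t.subst σ) = (φ.onTerm t).subst fun a => φ.onTerm (σ a) := by
  induction t with
  | var => rfl
  | func f ts ih => simp only [Term.subst, LHom.onTerm, ih]

namespace Atom

theorem subst_subst (A : Atom L α) (σ : α → L.Term β) (τ : β → L.Term γ) :
    (A.subst σ).subst τ = A.subst fun a => (σ a).subst τ := by
  simp only [Atom.subst, term_subst_subst]

theorem subst_var (A : Atom L α) : A.subst Term.var = A := by
  simp only [Atom.subst, term_subst_var]

theorem relabel_eq_subst (g : α → β) (A : Atom L α) :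
    A.relabel g = A.subst fun a => Term.var (g a) := by
  simp only [Atom.subst, Atom.relabel, term_relabel_eq_subst]

theorem onAtom_subst (φ : L →ᴸ L') (A : Atom L α) (σ : α → L.Term β) :
    (A.subst σ).onAtom φ = (A.onAtom φ).subst fun a => φ.onTerm (σ a) := by
  simp only [Atom.subst, Atom.onAtom, onTerm_subst]

theorem onAtom_relabel (φ : L →ᴸ L') (A : Atom L α) (g : α → β) :
    (A.relabel g).onAtom φ = (A.onAtom φ).relabel g := by
  simp only [relabel_eq_subst, onAtom_subst, LHom.onTerm]

theorem onAtom_comp {L'' : FirstOrder.Language} (ψ : L' →ᴸ L'') (φ : L →ᴸ L') (A : Atom L α) :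
    A.onAtom (ψ.comp φ) = (A.onAtom φ).onAtom ψ := by
  simp only [Atom.onAtom, LHom.comp_onTerm]
  rfl

theorem onAtom_id (A : Atom L α) : A.onAtom (LHom.id L) = A := by
  simp only [Atom.onAtom, LHom.id_onTerm]
  rfl

theorem closed_subst (A : Atom L Empty) (σ : α → L.Term β) :
    (A.relabel Empty.elim).subst σ = A.relabel Empty.elim := by
  simp only [relabel_eq_subst, subst_subst]
  congr 1
  funext x
  exact x.elim

end Atom

/-- The substitution `σ`, extended by the identity to new parameters. -/
def liftSubst (n : ℕ) (σ : α → L.Term β) : α ⊕ Fin n → L.Term (β ⊕ Fin n) :=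
  Sum.elim (fun a => (σ a).relabel Sum.inl) fun j => Term.var (Sum.inr j)

/-- Substitution of terms for the free variables of an alternative. -/
abbrev Alternative.subst (σ : α → L.Term β) (d : Alternative L α) : Alternative L β :=
  ⟨d.bound, d.atoms.map (Atom.subst · (liftSubst d.bound σ))⟩

theorem Alternative.relabel_eq_subst (g : α → β) (d : Alternative L α) :
    d.relabel g = d.subst fun a => Term.var (g a) := by
  simp only [Alternative.relabel, Alternative.subst, Alternative.mk.injEq, heq_eq_eq, true_and]
  refine List.map_congr_left fun A _ => ?_
  rw [Atom.relabel_eq_subst]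
  congr 1
  funext x
  rcases x with x | x <;> rfl

theorem Alternative.subst_subst (d : Alternative L α) (σ : α → L.Term β) (τ : β → L.Term γ) :
    (d.subst σ).subst τ = d.subst fun a => (σ a).subst τ := by
  simp only [Alternative.subst, List.map_map, Alternative.mk.injEq, heq_eq_eq, true_and]
  refine List.map_congr_left fun A _ => ?_
  simp only [Function.comp, Atom.subst_subst]
  congr 1
  funext x
  rcases x with x | x
  · simp [liftSubst, term_relabel_eq_subst, term_subst_subst, Term.subst]
  · rfl

theorem Alternative.subst_var (d : Alternative L α) : d.subst Term.var = d := by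
  rcases d with ⟨n, l⟩
  simp only [Alternative.subst, Alternative.mk.injEq, heq_eq_eq, true_and]
  conv_rhs => rw [← List.map_id l]
  refine List.map_congr_left fun A _ => ?_
  conv_rhs => rw [id, ← A.subst_var]
  congr 1
  funext x
  rcases x with x | x <;> rfl

theorem Alternative.onAlternative_subst (φ : L →ᴸ L') (d : Alternative L α) (σ : α → L.Term β) :
    (d.subst σ).onAlternative φ = (d.onAlternative φ).subst fun a => φ.onTerm (σ a) := by
  simp only [Alternative.subst, Alternative.onAlternative, List.map_map, Alternative.mk.injEq,
    heq_eq_eq, true_and]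
  refine List.map_congr_left fun A _ => ?_
  simp only [Function.comp, Atom.onAtom_subst]
  congr 1
  funext x
  rcases x with x | x
  · simp [liftSubst, term_relabel_eq_subst, onTerm_subst]
  · rfl

theorem Alternative.onAlternative_relabel (φ : L →ᴸ L') (d : Alternative L α) (g : α → β) :
    (d.relabel g).onAlternative φ = (d.onAlternative φ).relabel g := by
  simp only [relabel_eq_subst, onAlternative_subst, LHom.onTerm]

end Subst

/-! ## Structural properties of dynamical proofs -/

namespace Derives

variable {L : FirstOrder.Language.{u, v}} {L' : FirstOrder.Language.{u', v'}} {T : DynTheory L}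

/-- Dynamical proofs are stable under substitution and under addition of facts. -/
theorem subst {α : Type*} {Γ : Set (Atom L α)} {D : List (Alternative L α)}
    (h : Derives T α Γ D) {β : Type*} (σ : α → L.Term β) {Γ' : Set (Atom L β)}
    (hΓ : ∀ A ∈ Γ, A.subst σ ∈ Γ') : Derives T β Γ' (D.map (Alternative.subst σ)) := by
  induction h generalizing β with
  | leaf d hd t h =>
    refine leaf (d.subst σ) (List.mem_map_of_mem hd) (fun i => (t i).subst σ) fun B hB => ?_
    obtain ⟨A, hA, rfl⟩ := List.mem_map.1 hB
    convert hΓ _ (h A hA) using 1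
    rw [Atom.subst_subst, Atom.subst_subst]
    congr 1
    funext x
    rcases x with x | x
    · simp only [liftSubst, Sum.elim_inl, term_relabel_eq_subst, term_subst_subst, Term.subst]
      exact term_subst_var _
    · rfl
  | node r hr τ hyps branches ih =>
    refine node r hr (fun i => (τ i).subst σ) (fun A hA => ?_) fun d hd => ?_
    · rw [← Atom.subst_subst]
      exact hΓ _ (hyps A hA)
    · convert ih d hd (liftSubst d.bound σ) ?_ using 1
      · simp only [List.map_map]
        refine List.map_congr_left fun e _ => ?_
        simp only [Function.comp, Alternative.relabel_eq_subst, Alternative.subst_subst]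
        congr 1
        funext a
        simp [liftSubst, term_relabel_eq_subst, Term.subst]
      · rintro B (⟨A, hA, rfl⟩ | ⟨A, hA, rfl⟩)
        · refine Or.inl ⟨_, hΓ A hA, ?_⟩
          simp only [Atom.relabel_eq_subst, Atom.subst_subst]
          congr 1
          funext a
          simp [liftSubst, term_relabel_eq_subst, Term.subst]
        · refine Or.inr ⟨A, hA, ?_⟩
          rw [Atom.subst_subst]
          congr 1
          funext x
          rcases x with x | x
          · simp [liftSubst, term_relabel_eq_subst, term_subst_subst, Term.subst]
          · rfl

theorem mono {α : Type*} {Γ Γ' : Set (Atom L α)} {D : List (Alternative L α)}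
    (h : Derives T α Γ D) (hΓ : Γ ⊆ Γ') : Derives T α Γ' D := by
  have := h.subst Term.var (Γ' := Γ') fun A hA => by
    rw [A.subst_var]
    exact hΓ hA
  rwa [List.map_congr_left (g := id) fun d _ => d.subst_var, List.map_id] at this

/-- The cut rule: a dynamical proof of a disjunction may be continued in each of its branches. -/
theorem cut {α : Type*} {Γ : Set (Atom L α)} {E D : List (Alternative L α)}
    (h : Derives T α Γ E)
    (hE : ∀ d ∈ E, Derives T (α ⊕ Fin d.bound) (Atom.relabel Sum.inl '' Γ ∪ {A | A ∈ d.atoms})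
      (D.map (Alternative.relabel Sum.inl))) : Derives T α Γ D := by
  induction h with
  | leaf d hd t h =>
    -- The continuation after `d` was written for fresh parameters; the witnesses `t` found at the
    -- leaf take their place.
    have := (hE d hd).subst (Sum.elim Term.var t) (Γ' := _) (by
      rintro B (⟨A, hA, rfl⟩ | hB)
      · rw [Atom.relabel_eq_subst, Atom.subst_subst]
        change A.subst Term.var ∈ _
        rwa [A.subst_var]
      · exact h B hB)
    rwa [List.map_map, List.map_congr_left (g := id) fun d _ => ?_, List.map_id] at this
    rw [Function.comp, Alternative.relabel_eq_subst, Alternative.subst_subst]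
    exact d.subst_var
  | @node α Γ E r hr τ hyps branches ih =>
    refine node r hr τ hyps fun d hd => ih d hd fun e' he' => ?_
    obtain ⟨e, he, rfl⟩ := List.mem_map.1 he'
    -- The continuation is weakened to the parameters and facts that the branch `d` has added.
    have := (hE e he).subst (fun a => Term.var (Sum.map (Sum.inl (β := Fin d.bound)) id a))
      (Γ' := Atom.relabel Sum.inl '' (Atom.relabel Sum.inl '' Γ ∪ {B | ∃ A ∈ d.atoms,
        B = A.subst (Sum.elim (fun i => (τ i).relabel Sum.inl) fun j => Term.var (Sum.inr j))}) ∪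
        {A | A ∈ (e.relabel (Sum.inl (β := Fin d.bound))).atoms}) (fun A hA => ?_)
    · convert this using 1
      simp only [List.map_map]
      refine List.map_congr_left fun e _ => ?_
      simp only [Function.comp, Alternative.relabel_eq_subst, Alternative.subst_subst, Term.subst]
      rfl
    · rcases hA with ⟨A, hA, rfl⟩ | hA
      · refine Or.inl ⟨A.relabel Sum.inl, Or.inl ⟨A, hA, rfl⟩, ?_⟩
        simp only [Atom.relabel_eq_subst, Atom.subst_subst, Term.subst]
        rfl
      · refine Or.inr (List.mem_map.2 ⟨A, hA, ?_⟩)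
        rw [Atom.relabel_eq_subst]

/-- Dynamical proofs may be translated along an extension of theories. -/
theorem translate {φ : L →ᴸ L'} {T' : DynTheory L'} (hT : Extends φ T T')
    {α : Type*} {Γ : Set (Atom L α)} {D : List (Alternative L α)} (h : Derives T α Γ D) :
    Derives T' α (Atom.onAtom φ '' Γ) (D.map (Alternative.onAlternative φ)) := by
  induction h with
  | leaf d hd t h =>
    refine leaf (d.onAlternative φ) (List.mem_map_of_mem hd) (fun i => φ.onTerm (t i))
      fun B hB => ?_
    obtain ⟨A, hA, rfl⟩ := List.mem_map.1 hB
    refine ⟨_, h A hA, ?_⟩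
    rw [Atom.onAtom_subst]
    congr 1
    funext x
    rcases x with x | x <;> rfl
  | node r hr τ hyps branches ih =>
    -- The axiom `r` is only provable in `T'`: an instance of its proof is inserted, and the
    -- translated branches continue it.
    refine cut ((hT r hr).subst (fun i => φ.onTerm (τ i)) (Γ' := _) fun B hB => ?_)
      fun e he => ?_
    · obtain ⟨A, hA, rfl⟩ := List.mem_map.1 hB
      exact ⟨_, hyps A hA, Atom.onAtom_subst ..⟩
    · obtain ⟨e', he', rfl⟩ := List.mem_map.1 he
      obtain ⟨d, hd, rfl⟩ := List.mem_map.1 he'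
      have := ih d hd
      rw [List.map_map, show Alternative.onAlternative φ ∘ Alternative.relabel Sum.inl =
        Alternative.relabel Sum.inl ∘ Alternative.onAlternative φ from
          funext fun e => Alternative.onAlternative_relabel φ e _, ← List.map_map] at this
      refine this.mono ?_
      rintro _ ⟨B, (⟨A, hA, rfl⟩ | ⟨A, hA, rfl⟩), rfl⟩
      · exact Or.inl ⟨_, ⟨A, hA, rfl⟩, (Atom.onAtom_relabel ..).symm⟩
      · refine Or.inr (List.mem_map.2 ⟨_, List.mem_map_of_mem hA, ?_⟩)
        rw [Atom.onAtom_subst]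
        congr 1
        funext x
        rcases x with x | x
        · simp [liftSubst, term_relabel_eq_subst, onTerm_subst]
        · rfl

/-- A dynamical proof uses finitely many facts. -/
theorem exists_finite {α : Type*} {Γ : Set (Atom L α)} {D : List (Alternative L α)}
    (h : Derives T α Γ D) : ∃ Γ₀ ⊆ Γ, Γ₀.Finite ∧ Derives T α Γ₀ D := by
  induction h with
  | leaf d hd t h =>
    refine ⟨(fun A => A.subst (Sum.elim Term.var t)) '' {A | A ∈ d.atoms}, ?_,
      (List.finite_toSet _).image _, leaf d hd t fun A hA => ⟨A, hA, rfl⟩⟩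
    rintro _ ⟨A, hA, rfl⟩
    exact h A hA
  | @node α Γ D r hr τ hyps branches ih =>
    have key : ∀ d : {d // d ∈ r.concl}, ∃ Γ₀ ⊆ Γ, Γ₀.Finite ∧
        Derives T (α ⊕ Fin d.1.bound) (Atom.relabel Sum.inl '' Γ₀ ∪ {B | ∃ A ∈ d.1.atoms,
          B = A.subst (Sum.elim (fun i => (τ i).relabel Sum.inl)
            (fun j => Term.var (Sum.inr j)))}) (D.map (Alternative.relabel Sum.inl)) := by
      rintro ⟨d, hd⟩
      obtain ⟨Δ, hΔ, hf, h⟩ := ih d hd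
      -- Of the facts used in the branch, only those inherited from the root have to be traced back;
      -- the others come from the axiom itself.
      obtain ⟨Γ₀, h₀, hf₀, he⟩ := Set.exists_subset_image_finite_and
        (p := fun s => Δ ⊆ s ∪ {B | ∃ A ∈ d.atoms,
          B = A.subst (Sum.elim (fun i => (τ i).relabel Sum.inl)
            (fun j => Term.var (Sum.inr j)))}) |>.1
        ⟨Δ ∩ Atom.relabel Sum.inl '' Γ, Set.inter_subset_right, hf.inter_of_left _, fun A hA =>
          (hΔ hA).imp (fun h => ⟨hA, h⟩) id⟩
      exact ⟨Γ₀, h₀, hf₀, h.mono he⟩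
    choose G hG hf hd using key
    have : Finite {d // d ∈ r.concl} := List.finite_toSet r.concl
    refine ⟨(fun A => A.subst τ) '' {A | A ∈ r.hyps} ∪ ⋃ d, G d,
      Set.union_subset ?_ (Set.iUnion_subset hG),
      ((List.finite_toSet _).image _).union (Set.finite_iUnion hf),
      node r hr τ (fun A hA => Or.inl ⟨A, hA, rfl⟩) fun d h => (hd ⟨d, h⟩).mono ?_⟩
    · rintro _ ⟨A, hA, rfl⟩
      exact hyps A hA
    · exact Set.union_subset_union_left _ (Set.image_mono
        (Set.subset_union_of_subset_right (Set.subset_iUnion G ⟨d, h⟩) _))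

end Derives

/-! ## Facts -/

section Facts

variable {L : FirstOrder.Language.{u, v}} {L' : FirstOrder.Language.{u', v'}} {T : DynTheory L}
  {G : Type w} {R : Set (Atom L G)}

theorem FactValid.mono {R' : Set (Atom L G)} {A : Atom L G} (h : FactValid T G R A)
    (hR : R ⊆ R') : FactValid T G R' A :=
  Derives.mono h hR

theorem alternative_fact_subst {H : Type*} (σ : G → L.Term H) (A : Atom L G) :
    Alternative.subst σ ⟨0, [A.relabel Sum.inl]⟩ = ⟨0, [(A.subst σ).relabel Sum.inl]⟩ := by
  simp only [Alternative.subst, List.map_cons, List.map_nil, Atom.relabel_eq_subst,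
    Atom.subst_subst, Term.subst, liftSubst, Sum.elim_inl, term_relabel_eq_subst]

theorem FactValid.subst {A : Atom L G} (h : FactValid T G R A) {H : Type*} (σ : G → L.Term H)
    {R' : Set (Atom L H)} (hR : ∀ B ∈ R, B.subst σ ∈ R') : FactValid T H R' (A.subst σ) := by
  have := Derives.subst h σ hR
  rwa [List.map_singleton, alternative_fact_subst] at this

theorem FactValid.translate {φ : L →ᴸ L'} {T' : DynTheory L'} (hT : Extends φ T T')
    {A : Atom L G} (h : FactValid T G R A) :
    FactValid T' G (Atom.onAtom φ '' R) (A.onAtom φ) := by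
  have := Derives.translate hT h
  rwa [List.map_singleton, Alternative.onAlternative, List.map_singleton,
    Atom.onAtom_relabel] at this

theorem FactValid.of_mem {A : Atom L G} (h : A ∈ R) : FactValid T G R A := by
  refine Derives.leaf _ (List.mem_singleton_self _) (fun i => i.elim0) fun B hB => ?_
  obtain rfl := List.mem_singleton.1 hB
  rw [Atom.relabel_eq_subst, Atom.subst_subst]
  change A.subst Term.var ∈ R
  rwa [A.subst_var]

/-- Alternatives without bound variables: it is not necessary to add parameters. -/
theorem factValid_relabel {A : Atom L G} (h : FactValid T G R A) {R' : Set (Atom L (G ⊕ Fin 0))}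
    (hR : ∀ B ∈ R, B.relabel Sum.inl ∈ R') :
    Derives T (G ⊕ Fin 0) R' ([⟨0, [A.relabel Sum.inl]⟩].map (Alternative.relabel Sum.inl)) := by
  have := Derives.subst h (fun a => Term.var (Sum.inl (β := Fin 0) a)) (Γ' := R') fun B hB => by
    rw [← Atom.relabel_eq_subst]
    exact hR B hB
  rwa [List.map_congr_left (fun d _ => (Alternative.relabel_eq_subst _ d).symm)] at this

theorem FactValid.cut {A B : Atom L G} (hA : FactValid T G R A)
    (hB : FactValid T G (insert A R) B) : FactValid T G R B := by
  refine Derives.cut hA fun d hd => ?_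
  obtain rfl := List.mem_singleton.1 hd
  refine factValid_relabel hB fun C hC => ?_
  rcases hC with rfl | hC
  · exact Or.inr (List.mem_singleton_self _)
  · exact Or.inl ⟨C, hC, rfl⟩

theorem FactValid.cut_list {l : List (Atom L G)} {B : Atom L G}
    (hl : ∀ A ∈ l, FactValid T G R A) (hB : FactValid T G (R ∪ {A | A ∈ l}) B) :
    FactValid T G R B := by
  induction l with
  | nil => simpa using hB
  | cons A l ih =>
    refine ih (fun C hC => hl C (List.mem_cons_of_mem _ hC)) ?_
    refine FactValid.cut ((hl A List.mem_cons_self).mono Set.subset_union_left) (hB.mono ?_)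
    rintro C (hC | hC)
    · exact Or.inr (Or.inl hC)
    · rcases List.mem_cons.1 hC with rfl | hC
      · exact Or.inl rfl
      · exact Or.inr (Or.inr hC)

/-- Case distinction in the proof of a fact, by an axiom whose alternatives are single atomic
formulas without bound variables. -/
theorem FactValid.cases {n : ℕ} {Δ : List (Atom L (Fin n))} {B : Atom L G}
    (hr : (⟨n, [], Δ.map fun A => ⟨0, [A.relabel Sum.inl]⟩⟩ : Rule L) ∈ T) (σ : Fin n → L.Term G)
    (h : ∀ A ∈ Δ, FactValid T G (insert (A.subst σ) R) B) : FactValid T G R B := by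
  refine Derives.node _ hr σ (by simp) fun d hd => ?_
  obtain ⟨A, hA, rfl⟩ := List.mem_map.1 hd
  refine factValid_relabel (h A hA) fun C hC => ?_
  rcases hC with rfl | hC
  · refine Or.inr ⟨_, List.mem_singleton_self _, ?_⟩
    simp [Atom.relabel_eq_subst, Atom.subst_subst, Term.subst, term_relabel_eq_subst]
  · exact Or.inl ⟨C, hC, rfl⟩

theorem FactValid.of_axiom {n : ℕ} {hyps : List (Atom L (Fin n))} {A : Atom L (Fin n)}
    (hr : (⟨n, hyps, [⟨0, [A.relabel Sum.inl]⟩]⟩ : Rule L) ∈ T) (σ : Fin n → L.Term G)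
    (h : ∀ B ∈ hyps, FactValid T G R (B.subst σ)) : FactValid T G R (A.subst σ) := by
  refine FactValid.cut_list (l := hyps.map (Atom.subst · σ)) (by simpa using h) ?_
  refine Derives.node _ hr σ (fun B hB => Or.inr (List.mem_map.2 ⟨B, hB, rfl⟩)) fun d hd => ?_
  obtain rfl := List.mem_singleton.1 hd
  refine factValid_relabel (FactValid.of_mem (Set.mem_insert _ R)) fun C hC => ?_
  rcases hC with rfl | hC
  · refine Or.inr ⟨_, List.mem_singleton_self _, ?_⟩
    simp [Atom.relabel_eq_subst, Atom.subst_subst, Term.subst, term_relabel_eq_subst]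
  · exact Or.inl ⟨C, Or.inl hC, rfl⟩

/-- Finitely many variables occur in a term. -/
theorem exists_finset_term_subst (t : L.Term G) :
    ∃ s : Finset G, ∀ σ : G → L.Term G, (∀ g ∈ s, σ g = Term.var g) → t.subst σ = t := by
  classical
  induction t with
  | var g => exact ⟨{g}, fun σ h => h g (Finset.mem_singleton_self g)⟩
  | func f ts ih =>
    choose s hs using ih
    refine ⟨Finset.univ.biUnion s, fun σ h => ?_⟩
    simp only [Term.subst]
    congr 1
    funext i
    exact hs i σ fun g hg => h g (Finset.mem_biUnion.2 ⟨i, Finset.mem_univ i, hg⟩)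

theorem exists_finset_atom_subst (A : Atom L G) :
    ∃ s : Finset G, ∀ σ : G → L.Term G, (∀ g ∈ s, σ g = Term.var g) → A.subst σ = A := by
  classical
  choose s hs using fun i => exists_finset_term_subst (A.args i)
  refine ⟨Finset.univ.biUnion s, fun σ h => ?_⟩
  simp only [Atom.subst]
  congr 1
  funext i
  exact hs i σ fun g hg => h g (Finset.mem_biUnion.2 ⟨i, Finset.mem_univ i, hg⟩)

/-- A conservative extension is conservative for the validity of closed facts in dynamical
algebraic structures. -/
theorem ConservativeExtension.factValid {φ : L →ᴸ L'} {T' : DynTheory L'}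
    (hT : ConservativeExtension φ T T') {A : Atom L Empty} (c : L.Term Empty)
    (h : FactValid T' G (Atom.onAtom φ '' R) ((A.relabel Empty.elim).onAtom φ)) :
    FactValid T G R (A.relabel Empty.elim) := by
  classical
  obtain ⟨Δ, hΔ, hf, hd⟩ := Derives.exists_finite h
  obtain ⟨R₀, hR₀, hf₀, rfl⟩ := Set.exists_subset_image_finite_and
    (p := fun s => s = Δ) |>.1 ⟨Δ, hΔ, hf, rfl⟩
  choose s hs using exists_finset_atom_subst (L := L) (G := G)
  let S := hf₀.toFinset.biUnion s
  let e := S.equivFin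
  -- The finitely many generators in use become variables. The others do not occur in `R₀`, and the
  -- closed term `c` is an arbitrary value for them.
  let τ : G → L.Term (Fin S.card) := fun g =>
    if h : g ∈ S then Term.var (e ⟨g, h⟩) else c.relabel Empty.elim
  let ρ : Fin S.card → L.Term G := fun i => Term.var (e.symm i).1
  have hτ : ∀ B ∈ R₀, (B.subst τ).subst ρ = B := fun B hB => by
    rw [Atom.subst_subst]
    refine hs B _ fun g hg => ?_
    have : g ∈ S := Finset.mem_biUnion.2 ⟨B, hf₀.mem_toFinset.2 hB, hg⟩
    simp [τ, this, ρ, Term.subst]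
  -- The rule "`R₀` entails `A`", to which conservativity applies; `ρ` then turns its variables back
  -- into generators.
  have hV := hT.2 ⟨S.card, hf₀.toFinset.toList.map (Atom.subst · τ),
    [⟨0, [(A.relabel Empty.elim).relabel Sum.inl]⟩]⟩ ?_
  · have := FactValid.subst (A := A.relabel Empty.elim) hV ρ (R' := R) fun B hB => ?_
    · rwa [Atom.closed_subst] at this
    · obtain ⟨C, hC, rfl⟩ := List.mem_map.1 hB
      have hC := hf₀.mem_toFinset.1 (Finset.mem_toList.1 hC)
      rw [hτ C hC]
      exact hR₀ hC
  · have := FactValid.subst hd (fun g => φ.onTerm (τ g))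
      (R' := {B | B ∈ (hf₀.toFinset.toList.map (Atom.subst · τ)).map (Atom.onAtom φ)}) ?_
    · rw [← Atom.onAtom_subst, Atom.closed_subst] at this
      rw [FactValid, ← Atom.onAtom_relabel] at this
      exact this
    · rintro _ ⟨C, hC, rfl⟩
      simp only [← Atom.onAtom_subst]
      exact List.mem_map_of_mem (List.mem_map_of_mem
        (Finset.mem_toList.2 (hf₀.mem_toFinset.2 hC)))

end Facts

end Dynamical

/-! ## Preorderings and ordered fields -/

namespace RingPreordering

variable {A : Type*} [CommRing A]

/-- Zorn's lemma: the union of a nonempty chain of preorderings still omits -1, which would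
otherwise lie in a member of the chain. -/
theorem exists_le_maximal (P : RingPreordering A) :
    ∃ M : RingPreordering A, P ≤ M ∧ ∀ N : RingPreordering A, M ≤ N → N = M := by
  have hchain : ∀ c ⊆ Set.Ici P, IsChain (· ≤ ·) c → ∀ Q ∈ c, ∃ U, ∀ R ∈ c, R ≤ U := by
    intro c _ hc Q hQ
    refine ⟨mk' {x | ∃ R ∈ c, x ∈ R} ?_ ?_ (fun x => ⟨Q, hQ, Q.mul_self_mem x⟩) ?_,
      fun R hR x hx => ⟨R, hR, hx⟩⟩
    · rintro x y ⟨R, hR, hx⟩ ⟨S, hS, hy⟩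
      rcases hc.total hR hS with h | h
      · exact ⟨S, hS, add_mem (h hx) hy⟩
      · exact ⟨R, hR, add_mem hx (h hy)⟩
    · rintro x y ⟨R, hR, hx⟩ ⟨S, hS, hy⟩
      rcases hc.total hR hS with h | h
      · exact ⟨S, hS, mul_mem (h hx) hy⟩
      · exact ⟨R, hR, mul_mem hx (h hy)⟩
    · rintro ⟨R, hR, hx⟩
      exact R.neg_one_notMem hx
  obtain ⟨M, hPM, hM⟩ := zorn_le_nonempty_Ici₀ P hchain P le_rfl
  exact ⟨M, hPM, fun N hN => le_antisymm (hM hN) hN⟩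

/-- If `a` does not belong to a maximal preordering `M`, then `-1 ∈ M + a M`. -/
theorem exists_of_notMem_maximal {M : RingPreordering A}
    (hM : ∀ N : RingPreordering A, M ≤ N → N = M) {a : A} (ha : a ∉ M) :
    ∃ s ∈ M, ∃ t ∈ M, -1 = s + a * t := by
  by_contra hcon
  -- `M + a M` is closed under products because a² lies in `M`. If it omitted -1 it would be a
  -- preordering containing `M` and `a`, against maximality.
  let N : RingPreordering A := mk' {x | ∃ s ∈ M, ∃ t ∈ M, x = s + a * t}
    (by
      rintro x y ⟨s, hs, t, ht, rfl⟩ ⟨s', hs', t', ht', rfl⟩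
      exact ⟨s + s', add_mem hs hs', t + t', add_mem ht ht', by ring⟩)
    (by
      rintro x y ⟨s, hs, t, ht, rfl⟩ ⟨s', hs', t', ht', rfl⟩
      exact ⟨s * s' + a * a * (t * t'),
        add_mem (mul_mem hs hs') (mul_mem (M.mul_self_mem a) (mul_mem ht ht')),
        s * t' + t * s', add_mem (mul_mem hs ht') (mul_mem ht hs'), by ring⟩)
    (fun x => ⟨x * x, M.mul_self_mem x, 0, zero_mem M, by ring⟩) hcon
  have hN : N = M := hM N fun x hx => ⟨x, hx, 0, zero_mem M, by ring⟩
  apply ha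
  rw [← hN]
  exact ⟨0, zero_mem M, 1, one_mem M, by ring⟩

/-- If neither `a` nor `b` is in `M`, then 1 + s = -a t and 1 + s' = -b t' with s, t, s', t' in `M`.
Multiplying, (1 + s)(1 + s') = a b t t', so -(a b) in `M` would put -1 in `M`. -/
theorem isOrdering_of_maximal {M : RingPreordering A}
    (hM : ∀ N : RingPreordering A, M ≤ N → N = M) : M.IsOrdering := by
  rw [isOrdering_iff]
  intro a b hab
  by_contra! h
  obtain ⟨s, hs, t, ht, h₁⟩ := exists_of_notMem_maximal hM h.1
  obtain ⟨s', hs', t', ht', h₂⟩ := exists_of_notMem_maximal hM h.2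
  refine M.neg_one_notMem ?_
  have : -1 = s + s' + s * s' + -(a * b) * (t * t') := by
    linear_combination (1 + s') * h₁ - a * t * h₂
  rw [this]
  exact add_mem (add_mem (add_mem hs hs') (mul_mem hs hs')) (mul_mem hab (mul_mem ht ht'))

/-- An ordering of a field makes it a linearly ordered field. -/
theorem exists_linearOrder {K : Type*} [Field K] (P : RingPreordering K) :
    ∃ (_ : LinearOrder K) (_ : IsStrictOrderedRing K), ∀ x ∈ P, 0 ≤ x := by
  classical
  obtain ⟨M, hPM, hM⟩ := P.exists_le_maximal
  have hord := isOrdering_of_maximal hM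
  -- Over a field a preordering has zero support, so a maximal one is the nonnegative cone of a
  -- total order.
  let C : RingCone K :=
    { M.toSubsemiring with
      eq_zero_of_mem_of_neg_mem' := fun h h' => M.eq_zero_of_mem_of_neg_mem h h' }
  have : HasMemOrNegMem C := ⟨fun x => mem_or_neg_mem M x⟩
  let _ : LinearOrder K := LinearOrder.mkOfAddGroupCone C
  have : IsOrderedRing K := IsOrderedRing.mkOfCone C
  refine ⟨inferInstance, IsOrderedRing.toIsStrictOrderedRing K, fun x hx => ?_⟩
  change x - 0 ∈ C
  rw [sub_zero]
  exact hPM hx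

/-- A preordering with prime support extends to the field of fractions of the quotient by the
support. -/
theorem exists_linearOrder_of_fractions {M : RingPreordering A} [hord : M.IsOrdering]
    {K : Type*} [Field K] (f : A →+* K) (hf : ∀ x, f x = 0 ↔ x ∈ M.support)
    (hfrac : ∀ x, ∃ a b, f b ≠ 0 ∧ x = f a / f b) :
    ∃ (_ : LinearOrder K) (_ : IsStrictOrderedRing K), ∀ x ∈ M, 0 ≤ f x := by
  -- Square denominators make the sign of a fraction that of its numerator; an arbitrary a / b
  -- equals a b / b².
  let N : RingPreordering K := mk' {x | ∃ p ∈ M, ∃ q, f q ≠ 0 ∧ x = f p / f q ^ 2}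
    (by
      rintro x y ⟨p, hp, q, hq, rfl⟩ ⟨p', hp', q', hq', rfl⟩
      refine ⟨p * (q' * q') + p' * (q * q), add_mem (mul_mem hp (M.mul_self_mem q'))
        (mul_mem hp' (M.mul_self_mem q)), q * q', by simp [hq, hq'], ?_⟩
      simp only [map_add, map_mul]
      field_simp)
    (by
      rintro x y ⟨p, hp, q, hq, rfl⟩ ⟨p', hp', q', hq', rfl⟩
      refine ⟨p * p', mul_mem hp hp', q * q', by simp [hq, hq'], ?_⟩
      simp only [map_mul]
      field_simp)
    (by
      intro x
      obtain ⟨a, b, hb, rfl⟩ := hfrac x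
      refine ⟨a * a, M.mul_self_mem a, b, hb, ?_⟩
      rw [map_mul]
      field_simp)
    (by
      -- If -1 = p / q², then p + q² is in the support, so -q² is in `M` and q² is in the support.
      -- The support being prime, it contains q, so the denominator vanishes.
      rintro ⟨p, hp, q, hq, h⟩
      have h0 : f (p + q * q) = 0 := by
        rw [map_add, map_mul]
        field_simp at h
        linear_combination -h
      have h1 := (hf _).1 h0
      have h2 : q * q ∈ M.support := by
        refine ⟨M.mul_self_mem q, ?_⟩
        have := add_mem hp h1.2
        rwa [neg_add, add_neg_cancel_left] at this
      exact hq ((hf _).2 (Ideal.IsPrime.mem_or_mem inferInstance h2 |>.elim id id)))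
  obtain ⟨i₁, i₂, h⟩ := exists_linearOrder N
  exact ⟨i₁, i₂, fun x hx => h _ ⟨x, hx, 1, by simp, by simp⟩⟩

/-- A ring with a preordering has a homomorphism to a linearly ordered field that maps the elements
of the preordering to nonnegative elements. -/
theorem exists_ringHom {A : Type u} [CommRing A] (P : RingPreordering A) :
    ∃ (K : Type u) (_ : Field K) (_ : LinearOrder K) (_ : IsStrictOrderedRing K) (f : A →+* K),
      ∀ x ∈ P, 0 ≤ f x := by
  obtain ⟨M, hPM, hM⟩ := P.exists_le_maximal
  have hord := isOrdering_of_maximal hM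
  let f : A →+* FractionRing (A ⧸ M.support) :=
    (algebraMap (A ⧸ M.support) _).comp (Ideal.Quotient.mk M.support)
  obtain ⟨i₁, i₂, h⟩ := exists_linearOrder_of_fractions (M := M) f
    (fun x => by
      rw [← Ideal.Quotient.eq_zero_iff_mem]
      exact map_eq_zero_iff _ (IsFractionRing.injective (A ⧸ M.support) _))
    (fun x => by
      obtain ⟨a, b, hb, rfl⟩ := IsFractionRing.div_surjective (A := A ⧸ M.support) x
      obtain ⟨a, rfl⟩ := Ideal.Quotient.mk_surjective a
      obtain ⟨b, rfl⟩ := Ideal.Quotient.mk_surjective b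
      exact ⟨a, b, fun h => nonZeroDivisors.ne_zero hb
        (IsFractionRing.injective (A ⧸ M.support) _
          ((show algebraMap _ (FractionRing (A ⧸ M.support)) _ = 0 from h).trans
          (map_zero _).symm)), rfl⟩)
  exact ⟨_, inferInstance, i₁, i₂, f, fun x hx => h x (hPM hx)⟩

end RingPreordering

/-! ### Adjoining to an ordered field a root of a polynomial that changes sign -/

section RealRoots

open Polynomial

variable {K : Type u} [Field K] [LinearOrder K] [IsStrictOrderedRing K]

/-- The polynomials `c f²` with `c ≥ 0`. -/
noncomputable def sqMonoid (K : Type*) [Field K] [LinearOrder K] [IsStrictOrderedRing K] :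
    Submonoid K[X] where
  carrier := {p | ∃ c : K, 0 ≤ c ∧ ∃ f : K[X], p = C c * (f * f)}
  mul_mem' := by
    rintro _ _ ⟨c, hc, f, rfl⟩ ⟨d, hd, g, rfl⟩
    exact ⟨c * d, mul_nonneg hc hd, f * g, by rw [C_mul]; ring⟩
  one_mem' := ⟨1, zero_le_one, 1, by simp⟩

/-- Sums of squares of polynomials, with nonnegative coefficients. -/
noncomputable def sumSq (K : Type*) [Field K] [LinearOrder K] [IsStrictOrderedRing K] :
    Subsemiring K[X] :=
  (sqMonoid K).subsemiringClosure

theorem mul_self_mem_sumSq (f : K[X]) : f * f ∈ sumSq K :=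
  AddSubmonoid.subset_closure ⟨1, zero_le_one, f, by simp⟩

theorem C_mem_sumSq {c : K} (hc : 0 ≤ c) : C c ∈ sumSq K :=
  AddSubmonoid.subset_closure ⟨c, hc, 1, by simp⟩

theorem eval_nonneg_of_mem_sumSq {p : K[X]} (hp : p ∈ sumSq K) (x : K) : 0 ≤ p.eval x := by
  refine AddSubmonoid.closure_induction (motive := fun p _ => 0 ≤ p.eval x) ?_ (by simp) ?_ hp
  · rintro _ ⟨c, hc, f, rfl⟩
    simpa using mul_nonneg hc (mul_self_nonneg _)
  · intro p q _ _ hp hq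
    simpa using add_nonneg hp hq

/-- Each f² is replaced by the square of the remainder of f modulo `P`. This bounds the degree
without leaving the weighted sums of squares, which reducing `s` itself would not do. -/
theorem exists_reduction_of_mem_sumSq {P : K[X]} (hP : P.natDegree ≠ 0) {s : K[X]}
    (hs : s ∈ sumSq K) :
    ∃ s' ∈ sumSq K, P ∣ s - s' ∧ s'.natDegree ≤ 2 * (P.natDegree - 1) := by
  refine AddSubmonoid.closure_induction (motive := fun s _ => ∃ s' ∈ sumSq K, P ∣ s - s' ∧
    s'.natDegree ≤ 2 * (P.natDegree - 1)) ?_ ⟨0, zero_mem _, by simp⟩ ?_ hs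
  · rintro _ ⟨c, hc, f, rfl⟩
    refine ⟨C c * (f % P * (f % P)), AddSubmonoid.subset_closure ⟨c, hc, _, rfl⟩, ?_, ?_⟩
    · have : P ∣ f - f % P :=
      ⟨f / P, by linear_combination -(EuclideanDomain.div_add_mod f P)⟩
      convert this.mul_left (C c * (f + f % P)) using 1
      ring
    · have := natDegree_mod_lt f hP
      have h₁ := natDegree_C_mul_le c (f % P * (f % P))
      have h₂ := natDegree_mul_le (p := f % P) (q := f % P)
      omega
  · rintro p q _ _ ⟨p', hp', hp, hpd⟩ ⟨q', hq', hq, hqd⟩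
    refine ⟨p' + q', add_mem hp' hq', ?_, natDegree_add_le_of_degree_le hpd hqd⟩
    convert dvd_add hp hq using 1
    ring

/-- Infinite descent on the degree. The displayed sum is positive at `a` and at `b`, so its cofactor
`Q` has the sign of `P` at both points and changes sign too. After reduction modulo `P` the sum has
degree at most 2(n - 1) + 1, where n is the degree of `P`, so `Q` has degree at most n - 1 and
divides an expression of the same kind. -/
theorem not_dvd_one_add_sumSq {a b : K} (hab : a < b) :
    ∀ (n : ℕ) (P : K[X]), P.natDegree = n → P.eval a * P.eval b < 0 →
      ∀ s ∈ sumSq K, ∀ t ∈ sumSq K, ∀ r ∈ sumSq K,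
        ¬ P ∣ 1 + s + t * (X - C a) + r * (C b - X) := by
  intro n
  induction n using Nat.strong_induction_on with
  | _ n ih =>
    intro P hn hP s hs t ht r hr hdvd
    -- A constant does not change sign. Here the descent stops, and division by `P` lowers degrees
    -- from now on.
    have hP0 : P.natDegree ≠ 0 := fun h => by
      rw [eq_C_of_natDegree_eq_zero h, eval_C, eval_C] at hP
      exact (mul_self_nonneg _).not_gt hP
    obtain ⟨s', hs', hsd, hsn⟩ := exists_reduction_of_mem_sumSq hP0 hs
    obtain ⟨t', ht', htd, htn⟩ := exists_reduction_of_mem_sumSq hP0 ht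
    obtain ⟨r', hr', hrd, hrn⟩ := exists_reduction_of_mem_sumSq hP0 hr
    have hdvd' : P ∣ 1 + s' + t' * (X - C a) + r' * (C b - X) := by
      convert ((hdvd.sub hsd).sub (htd.mul_right (X - C a))).sub (hrd.mul_right (C b - X)) using 1
      ring
    obtain ⟨Q, hQ⟩ := hdvd'
    have ha := congrArg (eval a) hQ
    have hb := congrArg (eval b) hQ
    simp only [eval_add, eval_mul, eval_sub, eval_one, eval_X, eval_C, sub_self, mul_zero,
      add_zero] at ha hb
    have hpa : 0 < P.eval a * Q.eval a := by
      rw [← ha]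
      have := eval_nonneg_of_mem_sumSq hs' a
      have := mul_nonneg (eval_nonneg_of_mem_sumSq hr' a) (sub_nonneg.2 hab.le)
      linarith
    have hpb : 0 < P.eval b * Q.eval b := by
      rw [← hb]
      have := eval_nonneg_of_mem_sumSq hs' b
      have := mul_nonneg (eval_nonneg_of_mem_sumSq ht' b) (sub_nonneg.2 hab.le)
      linarith
    have hQs : Q.eval a * Q.eval b < 0 := by
      have := mul_pos hpa hpb
      by_contra! h
      have := mul_nonpos_of_nonpos_of_nonneg hP.le h
      linarith
    have hQ0 : Q ≠ 0 := by
      rintro rfl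
      simp at hQs
    have hP0' : P ≠ 0 := by
      rintro rfl
      simp at hP
    have hdeg : (P * Q).natDegree ≤ 2 * (P.natDegree - 1) + 1 := by
      rw [← hQ]
      have h₁ : (t' * (X - C a)).natDegree ≤ 2 * (P.natDegree - 1) + 1 :=
        natDegree_mul_le_of_le htn (natDegree_X_sub_C_le a)
      have h₂ : (r' * (C b - X)).natDegree ≤ 2 * (P.natDegree - 1) + 1 :=
        natDegree_mul_le_of_le hrn (by
          rw [← natDegree_neg, neg_sub]
          exact natDegree_X_sub_C_le b)
      refine natDegree_add_le_of_degree_le (natDegree_add_le_of_degree_le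
        (natDegree_add_le_of_degree_le ?_ ?_) h₁) h₂
      · simp
      · omega
    rw [natDegree_mul hP0' hQ0] at hdeg
    exact ih Q.natDegree (by omega) Q rfl hQs s' hs' t' ht' r' hr' ⟨P, hQ.trans (mul_comm _ _)⟩

/-- A polynomial that changes sign on an interval has a root, in this interval, in an extension of
the ordered field. -/
theorem exists_orderedField_root {a b : K} (hab : a < b) {P : K[X]}
    (hP : P.eval a * P.eval b < 0) :
    ∃ (K' : Type u) (_ : Field K') (_ : LinearOrder K') (_ : IsStrictOrderedRing K')
      (f : K →+* K') (x : K'), StrictMono f ∧ P.eval₂ f x = 0 ∧ f a < x ∧ x < f b := by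
  let u : K[X] := X - C a
  let v : K[X] := C b - X
  -- As u + v is the positive constant b - a, the product u v is a combination of u and v with
  -- coefficients in `sumSq K`. The preordering below thus needs no generator u v, and the descent
  -- needs no fourth term.
  have huv : u * v = C (b - a)⁻¹ * (v * (u * u) + u * (v * v)) := by
    have h : C (b - a)⁻¹ * (C b - C a) = (1 : K[X]) := by
      rw [← C_sub, ← C_mul, inv_mul_cancel₀ (sub_pos.2 hab).ne', C_1]
    simp only [u, v]
    linear_combination -(X - C a) * (C b - X) * h
  have hk : C (b - a)⁻¹ ∈ sumSq K := C_mem_sumSq (inv_nonneg.2 (sub_pos.2 hab).le)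
  have hu : u * u ∈ sumSq K := mul_self_mem_sumSq u
  have hv : v * v ∈ sumSq K := mul_self_mem_sumSq v
  let M : RingPreordering K[X] := RingPreordering.mk'
    {p | ∃ s ∈ sumSq K, ∃ t ∈ sumSq K, ∃ r ∈ sumSq K, ∃ q, p = s + t * u + r * v + P * q}
    (by
      rintro _ _ ⟨s, hs, t, ht, r, hr, q, rfl⟩ ⟨s', hs', t', ht', r', hr', q', rfl⟩
      exact ⟨s + s', add_mem hs hs', t + t', add_mem ht ht', r + r', add_mem hr hr', q + q',
        by ring⟩)
    (by
      rintro _ _ ⟨s, hs, t, ht, r, hr, q, rfl⟩ ⟨s', hs', t', ht', r', hr', q', rfl⟩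
      have hm : C (b - a)⁻¹ * (t * r' + r * t') ∈ sumSq K :=
        mul_mem hk (add_mem (mul_mem ht hr') (mul_mem hr ht'))
      exact ⟨s * s' + t * t' * (u * u) + r * r' * (v * v),
        add_mem (add_mem (mul_mem hs hs') (mul_mem (mul_mem ht ht') hu))
          (mul_mem (mul_mem hr hr') hv),
        s * t' + t * s' + C (b - a)⁻¹ * (t * r' + r * t') * (v * v),
        add_mem (add_mem (mul_mem hs ht') (mul_mem ht hs')) (mul_mem hm hv),
        s * r' + r * s' + C (b - a)⁻¹ * (t * r' + r * t') * (u * u),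
        add_mem (add_mem (mul_mem hs hr') (mul_mem hr hs')) (mul_mem hm hu),
        (s + t * u + r * v) * q' + q * (s' + t' * u + r' * v + P * q'),
        by linear_combination (t * r' + r * t') * huv⟩)
    (fun x => ⟨x * x, mul_self_mem_sumSq x, 0, zero_mem _, 0, zero_mem _, 0, by ring⟩)
    (by
      rintro ⟨s, hs, t, ht, r, hr, q, h⟩
      exact not_dvd_one_add_sumSq hab _ P rfl hP s hs t ht r hr
        ⟨-q, by simp only [u, v] at h; linear_combination -h⟩)
  obtain ⟨K', i₁, i₂, i₃, φ, hφ⟩ := M.exists_ringHom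
  have hφ₂ : ∀ p : K[X], p.eval₂ (φ.comp C) (φ X) = φ p := fun p => by
    rw [← coe_eval₂RingHom]
    congr 1
    ext <;> simp
  have hroot : φ P = 0 := by
    have h₁ := hφ P ⟨0, zero_mem _, 0, zero_mem _, 0, zero_mem _, 1, by ring⟩
    have h₂ := hφ (-P) ⟨0, zero_mem _, 0, zero_mem _, 0, zero_mem _, -1, by ring⟩
    rw [map_neg] at h₂
    linarith
  -- The preordering gives only a ≤ x ≤ b; the inequalities are strict because `P` does not vanish
  -- at the endpoints.
  have hne : ∀ c, P.eval c ≠ 0 → φ X ≠ φ (C c) := fun c hc h => by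
    rw [← hφ₂, h] at hroot
    change P.eval₂ (φ.comp C) ((φ.comp C) c) = 0 at hroot
    rw [eval₂_at_apply, map_eq_zero] at hroot
    exact hc hroot
  refine ⟨K', i₁, i₂, i₃, φ.comp C, φ X, ?_, by rw [hφ₂, hroot], ?_, ?_⟩
  · refine Monotone.strictMono_of_injective (fun c d hcd => ?_) (φ.comp C).injective
    have := hφ (C (d - c)) ⟨_, C_mem_sumSq (sub_nonneg.2 hcd), 0, zero_mem _, 0, zero_mem _, 0,
      by ring⟩
    rw [C_sub, map_sub] at this
    exact sub_nonneg.1 this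
  · have := hφ u ⟨0, zero_mem _, 1, one_mem _, 0, zero_mem _, 0, by ring⟩
    simp only [u, map_sub] at this
    exact lt_of_le_of_ne (sub_nonneg.1 this) (hne a (left_ne_zero_of_mul hP.ne)).symm
  · have := hφ v ⟨0, zero_mem _, 0, zero_mem _, 1, one_mem _, 0, by ring⟩
    simp only [v, map_sub] at this
    exact lt_of_le_of_ne (sub_nonneg.1 this) (hne b (right_ne_zero_of_mul hP.ne))

end RealRoots

namespace Dynamical

open FirstOrder FirstOrder.Language

/-! ## Substitution in terms and atomic formulas of the lattice-ordered signatures -/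

section TermLemmas

variable {b : Bool} {α β : Type*} (σ : α → (latLang b).Term β) (s t : (latLang b).Term α)

@[simp] theorem subst_zero : (0 : (latLang b).Term α).subst σ = 0 :=
  congrArg (Term.func _) (funext fun i => i.elim0)

@[simp] theorem subst_one : (1 : (latLang b).Term α).subst σ = 1 :=
  congrArg (Term.func _) (funext fun i => i.elim0)

@[simp] theorem subst_neg : (-s).subst σ = -s.subst σ :=
  congrArg (Term.func _) (funext fun i => by fin_cases i; rfl)

@[simp] theorem subst_add : (s + t).subst σ = s.subst σ + t.subst σ :=
  congrArg (Term.func _) (funext fun i => by fin_cases i <;> rfl)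

@[simp] theorem subst_mul : (s * t).subst σ = s.subst σ * t.subst σ :=
  congrArg (Term.func _) (funext fun i => by fin_cases i <;> rfl)

@[simp] theorem subst_sup : (s ⊔ t).subst σ = s.subst σ ⊔ t.subst σ :=
  congrArg (Term.func _) (funext fun i => by fin_cases i <;> rfl)

@[simp] theorem subst_sub : (s - t).subst σ = s.subst σ - t.subst σ := by
  change (s + -t).subst σ = s.subst σ + -t.subst σ
  rw [subst_add, subst_neg]

@[simp] theorem isZero_subst : (isZero s).subst σ = isZero (s.subst σ) :=
  congrArg (Atom.mk 1 _) (funext fun i => by fin_cases i; rfl)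

@[simp] theorem isNonneg_subst : (isNonneg s).subst σ = isNonneg (s.subst σ) :=
  congrArg (Atom.mk 1 _) (funext fun i => by fin_cases i; rfl)

@[simp] theorem eqTm_subst : (eqTm s t).subst σ = eqTm (s.subst σ) (t.subst σ) := by
  simp [eqTm]

@[simp] theorem geTm_subst : (geTm s t).subst σ = geTm (s.subst σ) (t.subst σ) := by
  simp [geTm]

theorem one_eq_zero_relabel (g : α → β) :
    (eqTm 1 0 : Atom (latLang b) α).relabel g = eqTm 1 0 := by
  rw [Atom.relabel_eq_subst, eqTm_subst, subst_one, subst_zero]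

end TermLemmas

/-! ### Compatibility of the inclusion of signatures with terms and atomic formulas -/

section Translation

variable {α : Type*} (s t : Sig.Term α)

@[simp] theorem sigIncl_zero : sigIncl.onTerm (0 : Sig.Term α) = 0 :=
  congrArg (Term.func _) (funext fun i => i.elim0)

@[simp] theorem sigIncl_one : sigIncl.onTerm (1 : Sig.Term α) = 1 :=
  congrArg (Term.func _) (funext fun i => i.elim0)

@[simp] theorem sigIncl_neg : sigIncl.onTerm (-s) = -sigIncl.onTerm s :=
  congrArg (Term.func _) (funext fun i => by fin_cases i; rfl)

@[simp] theorem sigIncl_add : sigIncl.onTerm (s + t) = sigIncl.onTerm s + sigIncl.onTerm t :=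
  congrArg (Term.func _) (funext fun i => by fin_cases i <;> rfl)

@[simp] theorem sigIncl_mul : sigIncl.onTerm (s * t) = sigIncl.onTerm s * sigIncl.onTerm t :=
  congrArg (Term.func _) (funext fun i => by fin_cases i <;> rfl)

@[simp] theorem sigIncl_sup : sigIncl.onTerm (s ⊔ t) = sigIncl.onTerm s ⊔ sigIncl.onTerm t :=
  congrArg (Term.func _) (funext fun i => by fin_cases i <;> rfl)

@[simp] theorem sigIncl_sub : sigIncl.onTerm (s - t) = sigIncl.onTerm s - sigIncl.onTerm t := by
  change sigIncl.onTerm (s + -t) = sigIncl.onTerm s + -sigIncl.onTerm t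
  rw [sigIncl_add, sigIncl_neg]

@[simp] theorem sigIncl_isZero : (isZero s).onAtom sigIncl = isZero (sigIncl.onTerm s) :=
  congrArg (Atom.mk 1 _) (funext fun i => by fin_cases i; rfl)

@[simp] theorem sigIncl_isNonneg : (isNonneg s).onAtom sigIncl = isNonneg (sigIncl.onTerm s) :=
  congrArg (Atom.mk 1 _) (funext fun i => by fin_cases i; rfl)

@[simp] theorem sigIncl_eqTm :
    (eqTm s t).onAtom sigIncl = eqTm (sigIncl.onTerm s) (sigIncl.onTerm t) := by
  simp [eqTm]

end Translation

/-! ## Ordered fields and the theory of discrete real closed fields with sup -/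

section Soundness

/-- The standard structure on a linearly ordered ring. -/
instance latStructure (b : Bool) (K : Type*) [CommRing K] [LinearOrder K] :
    (latLang b).Structure K where
  funMap f x := match f with
    | .zero => 0
    | .one => 1
    | .neg => -x 0
    | .add => x 0 + x 1
    | .mul => x 0 * x 1
    | .sup => x 0 ⊔ x 1
  RelMap R x := match R with
    | .eqZero _ => x 0 = 0
    | .nonneg _ => 0 ≤ x 0
    | .pos => 0 < x 0

/-- The atomic formula `A` is true under the assignment `x`. -/
def Atom.Holds {L : FirstOrder.Language.{u, v}} {α M : Type*} [L.Structure M] (A : Atom L α)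
    (x : α → M) : Prop :=
  Structure.RelMap A.rel fun i => (A.args i).realize x

section

variable {b : Bool} {α β : Type*} {K : Type*} [CommRing K] [LinearOrder K]
  (x : α → K) (s t : (latLang b).Term α)

@[simp] theorem realize_zero' : (0 : (latLang b).Term α).realize x = 0 := rfl
@[simp] theorem realize_one' : (1 : (latLang b).Term α).realize x = 1 := rfl
@[simp] theorem realize_neg' : (-s).realize x = -s.realize x := rfl
@[simp] theorem realize_add' : (s + t).realize x = s.realize x + t.realize x := rfl
@[simp] theorem realize_mul' : (s * t).realize x = s.realize x * t.realize x := rfl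
@[simp] theorem realize_sup' : (s ⊔ t).realize x = s.realize x ⊔ t.realize x := rfl
@[simp] theorem realize_sub' : (s - t).realize x = s.realize x - t.realize x :=
  (sub_eq_add_neg _ _).symm
@[simp] theorem holds_isZero : (isZero s).Holds x ↔ s.realize x = 0 := Iff.rfl
@[simp] theorem holds_isNonneg : (isNonneg s).Holds x ↔ 0 ≤ s.realize x := Iff.rfl
@[simp] theorem holds_isPos (s : SigPos.Term α) : (isPos s).Holds x ↔ 0 < s.realize x := Iff.rfl

@[simp] theorem holds_eqTm : (eqTm s t).Holds x ↔ s.realize x = t.realize x := by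
  rw [eqTm, holds_isZero, realize_sub', sub_eq_zero]

@[simp] theorem holds_geTm [IsOrderedRing K] :
    (geTm s t).Holds x ↔ t.realize x ≤ s.realize x := by
  rw [geTm, holds_isNonneg, realize_sub', sub_nonneg]

@[simp] theorem holds_gtTm [IsOrderedRing K] (s t : SigPos.Term α) :
    (gtTm s t).Holds x ↔ t.realize x < s.realize x := by
  rw [gtTm, holds_isPos, realize_sub', sub_pos]

@[simp] theorem realize_powTm (n : ℕ) : (powTm s n).realize x = s.realize x ^ n := by
  induction n with
  | zero => simp [powTm]
  | succ n ih => simp [powTm, ih, pow_succ]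

theorem realize_list_sum (l : List ((latLang b).Term α)) :
    l.sum.realize x = (l.map (Term.realize x)).sum := by
  induction l with
  | nil => rfl
  | cons t l ih => rw [List.sum_cons, realize_add', ih, List.map_cons, List.sum_cons]

@[simp] theorem realize_polyTm {n : ℕ} (a : Fin (n + 1) → (latLang b).Term α) :
    (polyTm a t).realize x = ∑ k, (a k).realize x * t.realize x ^ (k : ℕ) := by
  rw [polyTm, realize_list_sum, List.map_ofFn, List.sum_ofFn]
  simp

end

section

variable {L : FirstOrder.Language.{u, v}} {α β M : Type*} [L.Structure M]

theorem Atom.holds_subst (A : Atom L α) (σ : α → L.Term β) (x : β → M) :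
    (A.subst σ).Holds x ↔ A.Holds fun a => (σ a).realize x := by
  simp only [Atom.Holds, Atom.subst, Term.realize_subst]

theorem Atom.holds_relabel (A : Atom L α) (g : α → β) (x : β → M) :
    (A.relabel g).Holds x ↔ A.Holds (x ∘ g) := by
  simp only [Atom.Holds, Atom.relabel, Term.realize_relabel]

end

theorem realize_map {b : Bool} {α K K' : Type*} [CommRing K] [LinearOrder K] [CommRing K']
    [LinearOrder K'] {f : K →+* K'} (hf : Monotone f) (x : α → K) (t : (latLang b).Term α) :
    t.realize (fun a => f (x a)) = f (t.realize x) := by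
  induction t with
  | var => rfl
  | func g ts ih =>
    simp only [Term.realize, ih]
    cases g
    · exact (map_zero f).symm
    · exact (map_one f).symm
    · exact (map_neg f _).symm
    · exact (map_add f _ _).symm
    · exact (map_mul f _ _).symm
    · exact hf.map_max.symm

/-- Embeddings of linearly ordered rings preserve atomic formulas. -/
theorem Atom.Holds.map {b : Bool} {α K K' : Type*} [CommRing K] [LinearOrder K] [CommRing K']
    [LinearOrder K'] {f : K →+* K'} (hf : StrictMono f) {A : Atom (latLang b) α}
    {x : α → K} (h : A.Holds x) : A.Holds fun a => f (x a) := by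
  obtain ⟨n, R, ts⟩ := A
  simp only [Atom.Holds, realize_map hf.monotone] at h ⊢
  cases R
  · exact (congrArg f h).trans (map_zero f)
  · exact (map_zero f).symm.trans_le (hf.monotone h)
  · exact (map_zero f).symm.trans_lt (hf h)

/-- In every instance of the rule `r` in the linearly ordered field `K`, an alternative of the
conclusion is satisfied in an extension of `K`. -/
def Rule.WeaklySatisfied (r : Rule SigPos) (K : Type w) [Field K] [LinearOrder K] : Prop :=
  ∀ x : Fin r.vars → K, (∀ A ∈ r.hyps, A.Holds x) →
    ∃ (K' : Type w) (_ : Field K') (_ : LinearOrder K') (_ : IsStrictOrderedRing K')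
      (f : K →+* K'), StrictMono f ∧ ∃ d ∈ r.concl, ∃ y : Fin d.bound → K',
        ∀ A ∈ d.atoms, A.Holds (Sum.elim (fun i => f (x i)) y)

variable {K : Type w} [Field K] [LinearOrder K] [IsStrictOrderedRing K]

theorem weaklySatisfied_of_exists {r : Rule SigPos}
    (h : ∀ x : Fin r.vars → K, (∀ A ∈ r.hyps, A.Holds x) → ∃ d ∈ r.concl,
      ∃ y : Fin d.bound → K, ∀ A ∈ d.atoms, A.Holds (Sum.elim x y)) : r.WeaklySatisfied K :=
  fun x hx => ⟨K, inferInstance, inferInstance, inferInstance, RingHom.id K, strictMono_id, h x hx⟩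

theorem weaklySatisfied_algRule {n : ℕ}
    {p : List (Atom SigPos (Fin n)) × Atom SigPos (Fin n)}
    (h : ∀ x : Fin n → K, (∀ A ∈ p.1, A.Holds x) → p.2.Holds x) :
    (algRule n p).WeaklySatisfied K := by
  refine weaklySatisfied_of_exists fun x hx =>
    ⟨_, List.mem_singleton_self _, fun i => i.elim0, fun A hA => ?_⟩
  obtain rfl := List.mem_singleton.1 hA
  rw [Atom.holds_relabel]
  exact h x hx

theorem weaklySatisfied_disj₁ {f : SigPos.Term (Fin 1) → List (Atom SigPos (Fin 1))}
    (h : ∀ x : Fin 1 → K, ∃ A ∈ f (Term.var 0), A.Holds x) :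
    (disj₁ f).WeaklySatisfied K := by
  refine weaklySatisfied_of_exists fun x hx => ?_
  obtain ⟨A, hA, hAx⟩ := h x
  refine ⟨_, List.mem_map_of_mem hA, fun i => i.elim0, fun B hB => ?_⟩
  obtain rfl := List.mem_singleton.1 hB
  rw [Atom.holds_relabel]
  exact hAx

theorem weaklySatisfied_equalityAxioms {r : Rule SigPos} (hr : r ∈ equalityAxioms true) :
    r.WeaklySatisfied K := by
  simp only [equalityAxioms, Set.mem_insert_iff, Set.mem_singleton_iff] at hr
  rcases hr with rfl | rfl | rfl | rfl | rfl | rfl | rfl | rfl | rfl | rfl <;>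
  · refine weaklySatisfied_algRule fun x hx => ?_
    simp at hx ⊢
    try grind

theorem weaklySatisfied_ringAxioms {r : Rule SigPos} (hr : r ∈ ringAxioms true) :
    r.WeaklySatisfied K := by
  simp only [ringAxioms, Set.mem_insert_iff, Set.mem_singleton_iff] at hr
  rcases hr with rfl | rfl | rfl | rfl | rfl | rfl | rfl | rfl | rfl | rfl | rfl <;>
  · refine weaklySatisfied_algRule fun x hx => ?_
    simp at hx ⊢
    try grind

theorem weaklySatisfied_orderedFieldAxioms {r : Rule SigPos} (hr : r ∈ orderedFieldAxioms) :
    r.WeaklySatisfied K := by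
  simp only [orderedFieldAxioms, Set.mem_insert_iff, Set.mem_singleton_iff] at hr
  rcases hr with rfl | rfl | rfl | rfl | rfl | rfl | rfl | rfl | rfl | rfl | rfl | rfl | rfl |
    rfl | rfl
  · exact weaklySatisfied_algRule fun x hx => by simp at hx ⊢; exact hx.ge
  · exact weaklySatisfied_algRule fun x hx => by simp at hx ⊢; exact add_nonneg hx.1 hx.2
  · exact weaklySatisfied_algRule fun x hx => by simp; exact mul_self_nonneg _
  · exact weaklySatisfied_algRule fun x hx => by simp at hx ⊢; exact mul_nonneg hx.1 hx.2
  · exact weaklySatisfied_algRule fun x hx => by simp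
  · exact weaklySatisfied_algRule fun x hx => by simp at hx ⊢; exact hx.le
  · exact weaklySatisfied_algRule fun x hx => by
      simp at hx ⊢; exact add_pos_of_pos_of_nonneg hx.1 hx.2
  · exact weaklySatisfied_algRule fun x hx => by simp at hx ⊢; exact mul_pos hx.1 hx.2
  · exact weaklySatisfied_algRule fun x hx => by simp at hx ⊢; exact hx.1 ▸ hx.2
  · exact weaklySatisfied_algRule fun x hx => by simp at hx
  · exact weaklySatisfied_algRule fun x hx => by simp at hx ⊢; exact le_antisymm hx.2 hx.1
  · exact weaklySatisfied_algRule fun x hx => by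
      simp at hx ⊢; exact left_ne_zero_of_mul_eq_one hx
  · refine weaklySatisfied_of_exists fun x hx =>
      ⟨_, List.mem_singleton_self _, fun _ => (x 0)⁻¹, ?_⟩
    simp at hx ⊢
    exact mul_inv_cancel₀ hx.ne'
  · refine weaklySatisfied_disj₁ fun x => ?_
    simp
    exact le_total _ _
  · refine weaklySatisfied_disj₁ fun x => ?_
    simp
    exact eq_or_ne _ _

/-- The axioms for which weak satisfaction is needed: `K` itself may have no root, and one is
adjoined. -/
theorem weaklySatisfied_rcfAxiom (n : ℕ) : (rcfAxiom n).WeaklySatisfied K := by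
  intro x hx
  simp at hx
  obtain ⟨hab, hP⟩ := hx
  let P : Polynomial K := ∑ k : Fin (n + 1),
    Polynomial.C (x (Fin.castAdd 2 k)) * Polynomial.X ^ (k : ℕ)
  obtain ⟨K', i₁, i₂, i₃, f, z, hf, hz, hz₁, hz₂⟩ := exists_orderedField_root hab (P := P) (by
    simpa [P, Polynomial.eval_finsetSum] using hP)
  refine ⟨K', i₁, i₂, i₃, f, hf, _, List.mem_singleton_self _, fun _ => z, ?_⟩
  simp
  exact ⟨by simpa [P, Polynomial.eval₂_finsetSum] using hz, hz₁, hz₂⟩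

theorem weaklySatisfied_of_mem_Crcdsup {r : Rule SigPos} (hr : r ∈ Crcdsup) :
    r.WeaklySatisfied K := by
  rcases hr with (((hr | hr) | hr) | ⟨n, rfl⟩) | hr
  · exact weaklySatisfied_equalityAxioms hr
  · exact weaklySatisfied_ringAxioms hr
  · exact weaklySatisfied_orderedFieldAxioms hr
  · exact weaklySatisfied_rcfAxiom n
  · simp only [Set.mem_insert_iff, Set.mem_singleton_iff] at hr
    rcases hr with rfl | rfl | rfl <;>
    · refine weaklySatisfied_algRule fun x hx => ?_
      simp at hx ⊢
      try exact hx

/-- A presentation that is satisfied in a linearly ordered field does not collapse. -/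
theorem not_factValid_Crcdsup {G : Type*} {R : Set (Atom SigPos G)} (x : G → K)
    (hx : ∀ A ∈ R, A.Holds x) : ¬ FactValid Crcdsup G R (eqTm 1 0) := by
  intro h
  rw [FactValid] at h
  generalize hD : [(⟨0, [(eqTm 1 0 : Atom SigPos G).relabel Sum.inl]⟩ : Alternative SigPos G)] = D
    at h
  induction h generalizing K with
  | leaf d hd t h =>
    subst hD
    obtain rfl := List.mem_singleton.1 hd
    have := hx _ (h _ (List.mem_singleton_self _))
    rw [Atom.holds_subst, Atom.holds_relabel] at this
    simp at this
  | node r hr σ hyps branches ih =>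
    subst hD
    -- The alternative true in `K'` selects the branch to follow. The earlier facts stay true there,
    -- as strictly monotone homomorphisms preserve atomic formulas.
    obtain ⟨K', i₁, i₂, i₃, f, hf, d, hd, y, hy⟩ := weaklySatisfied_of_mem_Crcdsup hr
      (fun i => (σ i).realize x) fun A hA => (A.holds_subst σ x).1 (hx _ (hyps A hA))
    refine ih d hd (K := K') (Sum.elim (fun a => f (x a)) y) ?_ ?_
    · rintro _ (⟨A, hA, rfl⟩ | ⟨A, hA, rfl⟩)
      · rw [Atom.holds_relabel]
        exact (hx A hA).map hf
      · rw [Atom.holds_subst]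
        convert hy A hA using 1
        funext i
        rcases i with i | i
        · simp [Function.comp_def, realize_map hf.monotone]
        · rfl
    · simp only [List.map_singleton, Alternative.relabel, one_eq_zero_relabel]

end Soundness

end Dynamical

/-! ## Strongly lattice-ordered rings -/

section LatticeOrderedRing

/-- In a unital lattice-ordered ring in which the multiplications by nonnegative elements preserve
the suprema, the nonnegative elements are a preordering and the
positive and negative parts of an element are orthogonal. -/
theorem exists_preordering_of_posPart_mul_sup {A : Type*} [CommRing A] [Nontrivial A] [Lattice A]
    [IsOrderedAddMonoid A]
    (h : ∀ x y z : A, (x ⊔ 0) * (y ⊔ z) = (x ⊔ 0) * y ⊔ (x ⊔ 0) * z) :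
    ∃ P : RingPreordering A, (∀ x, x ∈ P ↔ 0 ≤ x) ∧ ∀ x : A, x⁺ * x⁻ = 0 := by
  have mul_sup' : ∀ {c : A}, 0 ≤ c → ∀ y z, c * (y ⊔ z) = c * y ⊔ c * z := fun {c} hc y z => by
    have := h c y z
    rwa [sup_eq_left.2 hc] at this
  have mul_inf' : ∀ {c : A}, 0 ≤ c → ∀ y z, c * (y ⊓ z) = c * y ⊓ c * z := fun {c} hc y z => by
    have := mul_sup' hc (-y) (-z)
    rw [← neg_inf, mul_neg, mul_neg, mul_neg, ← neg_inf] at this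
    exact neg_injective this
  have mul_nn : ∀ {x y : A}, 0 ≤ x → 0 ≤ y → 0 ≤ x * y := fun {x y} hx hy => by
    have := mul_sup' hx y 0
    rw [sup_eq_left.2 hy, mul_zero] at this
    rw [this]
    exact le_sup_right
  have mul_mono : ∀ {x y z : A}, x ≤ y → 0 ≤ z → x * z ≤ y * z := fun {x y z} hxy hz => by
    have := mul_nn (sub_nonneg.2 hxy) hz
    rwa [sub_mul, sub_nonneg] at this
  -- Multiplying a nonnegative p by 1 ⊔ 0 gives p, and by -1 ⊔ 0 gives 0. The product of these two
  -- elements is therefore both -1 ⊔ 0 and 0.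
  have one_nn : (0 : A) ≤ 1 := by
    have h₁ : ∀ p : A, 0 ≤ p → p * (1 ⊔ 0) = p := fun p hp => by
      rw [mul_sup' hp, mul_one, mul_zero, sup_eq_left.2 hp]
    have h₂ : ∀ p : A, 0 ≤ p → p * (-1 ⊔ 0) = 0 := fun p hp => by
      rw [mul_sup' hp, mul_neg_one, mul_zero, sup_eq_right.2 (neg_nonpos.2 hp)]
    have h₃ : (-1 ⊔ 0 : A) = 0 := by
      rw [← h₁ (-1 ⊔ 0) le_sup_right, mul_comm]
      exact h₂ _ le_sup_right
    exact neg_nonpos.1 (sup_eq_right.1 h₃)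
  -- With d = c ⊔ 1 one has c a ≤ d a and b ≤ d b, while d a ⊓ d b = d (a ⊓ b) = 0.
  have mul_inf_eq : ∀ {a b c : A}, 0 ≤ a → 0 ≤ b → 0 ≤ c → a ⊓ b = 0 → c * a ⊓ b = 0 := by
    intro a b c ha hb hc hab
    refine le_antisymm ?_ (le_inf (mul_nn hc ha) hb)
    have := mul_inf' (one_nn.trans (le_sup_right : 1 ≤ c ⊔ 1)) a b
    rw [hab, mul_zero] at this
    rw [this]
    refine inf_le_inf (mul_mono le_sup_left ha) ?_
    simpa using mul_mono (le_sup_right : 1 ≤ c ⊔ 1) hb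
  -- Start from x⁺ ⊓ x⁻ = 0 and multiply the first member by x⁻, then the second by x⁺: the product
  -- x⁺ x⁻ is disjoint from itself.
  have orth : ∀ x : A, x⁺ * x⁻ = 0 := fun x => by
    have hp := posPart_nonneg x
    have hq := negPart_nonneg x
    have h₁ : x⁻ * x⁺ ⊓ x⁻ = 0 := mul_inf_eq hp hq hq (posPart_inf_negPart_eq_zero x)
    have h₂ : x⁺ * x⁻ ⊓ x⁻ * x⁺ = 0 :=
      mul_inf_eq hq (mul_nn hq hp) hp (by rw [inf_comm, h₁])
    rwa [mul_comm x⁻, inf_idem] at h₂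
  have mul_self_nn : ∀ x : A, 0 ≤ x * x := fun x => by
    have : x * x = x⁺ * x⁺ + x⁻ * x⁻ := by
      conv_lhs => rw [← posPart_sub_negPart x]
      linear_combination -2 * orth x
    rw [this]
    exact add_nonneg (mul_nn (posPart_nonneg x) (posPart_nonneg x))
      (mul_nn (negPart_nonneg x) (negPart_nonneg x))
  exact ⟨RingPreordering.mk' {x | 0 ≤ x} add_nonneg mul_nn mul_self_nn fun hn =>
    one_ne_zero (le_antisymm (neg_nonneg.1 hn) one_nn), fun x => Iff.rfl, orth⟩

/-- A strongly lattice-ordered ring has a homomorphism to a linearly ordered field. -/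
theorem exists_ringHom_map_sup {A : Type u} [CommRing A] [Nontrivial A] [Max A]
    (idem : ∀ x : A, x ⊔ x = x) (comm : ∀ x y : A, x ⊔ y = y ⊔ x)
    (assoc : ∀ x y z : A, x ⊔ y ⊔ z = x ⊔ (y ⊔ z))
    (add : ∀ x y z : A, x + (y ⊔ z) = (x + y) ⊔ (x + z))
    (mul : ∀ x y z : A, (x ⊔ 0) * (y ⊔ z) = (x ⊔ 0) * y ⊔ (x ⊔ 0) * z) :
    ∃ (K : Type u) (_ : Field K) (_ : LinearOrder K) (_ : IsStrictOrderedRing K) (f : A →+* K),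
      ∀ x y, f (x ⊔ y) = f x ⊔ f y := by
  let S : SemilatticeSup A := SemilatticeSup.mk' comm assoc idem
  have hle : ∀ x y : A, x ≤ y ↔ x ⊔ y = y := fun x y => Iff.rfl
  have : IsOrderedAddMonoid A :=
    { add_le_add_left := fun x y hxy z => by
        rw [hle] at hxy ⊢
        rw [add_comm x, add_comm y, ← add, hxy] }
  have hneg : ∀ x y : A, x ≤ y → -y ≤ -x := fun x y hxy => neg_le_neg hxy
  -- Negation reverses the order, so infima come from suprema.
  let _ : Lattice A :=
    { S with
      inf := fun x y => -(-x ⊔ -y)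
      inf_le_left := fun x y => by
        simpa using hneg _ _ (le_sup_left : -x ≤ -x ⊔ -y)
      inf_le_right := fun x y => by
        simpa using hneg _ _ (le_sup_right : -y ≤ -x ⊔ -y)
      le_inf := fun x y z hxy hxz => by
        simpa using hneg _ _ (sup_le (hneg _ _ hxy) (hneg _ _ hxz)) }
  obtain ⟨P, hP, orth⟩ := exists_preordering_of_posPart_mul_sup mul
  obtain ⟨K, i₁, i₂, i₃, f, hf⟩ := P.exists_ringHom
  -- The images of x⁺ and x⁻ are nonnegative with difference f x and product 0. In a field one of
  -- them vanishes, so the image of x⁺ is the positive part of f x.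
  have hpos : ∀ x : A, f (x ⊔ 0) = f x ⊔ 0 := fun x => by
    have h₁ : 0 ≤ f (x ⊔ 0) := hf _ ((hP _).2 le_sup_right)
    have h₂ : 0 ≤ f (-x ⊔ 0) := hf _ ((hP _).2 le_sup_right)
    have h₃ : f (x ⊔ 0) * f (-x ⊔ 0) = 0 := by
      rw [← map_mul, ← map_zero f]
      exact congrArg f (orth x)
    have h₄ : f (x ⊔ 0) = f x + f (-x ⊔ 0) := by
      rw [← map_add, add, add_neg_cancel, add_zero, comm]
    rcases mul_eq_zero.1 h₃ with h | h
    · rw [h, sup_eq_right.2]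
      linarith
    · rw [h, add_zero] at h₄
      rw [h₄, sup_eq_left.2]
      linarith
  refine ⟨K, i₁, i₂, i₃, f, fun x y => ?_⟩
  have h : x ⊔ y = y + ((x - y) ⊔ 0) := by rw [add, add_sub_cancel, add_zero]
  rw [h, map_add, hpos, map_sub, ← max_add_add_left, add_sub_cancel, add_zero]

end LatticeOrderedRing

namespace Dynamical

open FirstOrder FirstOrder.Language

/-! ## The ring of terms -/

/-- Theories which include the axioms of equality and those of commutative rings. -/
class RingTheory {b : Bool} (T : DynTheory (latLang b)) : Prop where
  equality_subset : equalityAxioms b ⊆ T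
  ring_subset : ringAxioms b ⊆ T

section TermRing

variable {b : Bool} {T : DynTheory (latLang b)} {G : Type w}
  {R : Set (Atom (latLang b) G)} {s t r : (latLang b).Term G}

@[simp] theorem subst_of_var {L : FirstOrder.Language} {α β : Type*} (σ : α → L.Term β) (a : α) :
    (Term.var a : L.Term α).subst σ = σ a := rfl

/-! ### Equality and ring axioms as rules for deriving facts -/

section Facts

variable [hT : RingTheory T]

variable (T R s) in
theorem factValid_refl : FactValid T G R (eqTm s s) := by
  simpa [-Term.subst] using FactValid.of_axiom (G := G) (R := R)
    (hT.equality_subset (Or.inl rfl)) ![s] (by simp)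

theorem FactValid.symm (h₁ : FactValid T G R (eqTm s t)) :
    FactValid T G R (eqTm t s) := by
  simpa [-Term.subst] using FactValid.of_axiom (G := G) (R := R)
    (hT.equality_subset (Or.inr (Or.inl rfl))) ![s, t]
    (by simpa [-Term.subst] using h₁)

theorem FactValid.trans (h₁ : FactValid T G R (eqTm s t)) (h₂ : FactValid T G R (eqTm t r)) :
    FactValid T G R (eqTm s r) := by
  simpa [-Term.subst] using FactValid.of_axiom (G := G) (R := R)
    (hT.equality_subset (Or.inr (Or.inr (Or.inl rfl)))) ![s, t, r]
    (by simpa [-Term.subst] using ⟨h₁, h₂⟩)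

theorem FactValid.neg_congr (h₁ : FactValid T G R (eqTm s t)) :
    FactValid T G R (eqTm (-s) (-t)) := by
  simpa [-Term.subst] using FactValid.of_axiom (G := G) (R := R)
    (hT.equality_subset (Or.inr (Or.inr (Or.inr (Or.inl rfl))))) ![s, t]
    (by simpa [-Term.subst] using h₁)

theorem FactValid.add_congr_left (h₁ : FactValid T G R (eqTm s t)) :
    FactValid T G R (eqTm (s + r) (t + r)) := by
  simpa [-Term.subst] using FactValid.of_axiom (G := G) (R := R)
    (hT.equality_subset (Or.inr (Or.inr (Or.inr (Or.inr (Or.inl rfl)))))) ![s, t, r]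
    (by simpa [-Term.subst] using h₁)

theorem FactValid.mul_congr_left (h₁ : FactValid T G R (eqTm s t)) :
    FactValid T G R (eqTm (s * r) (t * r)) := by
  simpa [-Term.subst] using FactValid.of_axiom (G := G) (R := R)
    (hT.equality_subset (Or.inr (Or.inr (Or.inr (Or.inr (Or.inr (Or.inl rfl))))))) ![s, t, r]
    (by simpa [-Term.subst] using h₁)

theorem FactValid.sup_congr_left (h₁ : FactValid T G R (eqTm s t)) :
    FactValid T G R (eqTm (s ⊔ r) (t ⊔ r)) := by
  simpa [-Term.subst] using FactValid.of_axiom (G := G) (R := R)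
    (hT.equality_subset (Or.inr (Or.inr (Or.inr (Or.inr (Or.inr (Or.inr (Or.inl rfl))))))))
    ![s, t, r]
    (by simpa [-Term.subst] using h₁)

theorem FactValid.sup_congr_right (h₁ : FactValid T G R (eqTm s t)) :
    FactValid T G R (eqTm (r ⊔ s) (r ⊔ t)) := by
  simpa [-Term.subst] using FactValid.of_axiom (G := G) (R := R)
    (hT.equality_subset (Or.inr (Or.inr (Or.inr (Or.inr (Or.inr (Or.inr (Or.inr (Or.inl rfl)))))))))
    ![s, t, r]
    (by simpa [-Term.subst] using h₁)

theorem FactValid.isZero_congr (h₁ : FactValid T G R (eqTm s t)) (h₂ : FactValid T G R (isZero s)) :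
    FactValid T G R (isZero t) := by
  simpa [-Term.subst] using FactValid.of_axiom (G := G) (R := R)
    (hT.equality_subset (Or.inr (Or.inr (Or.inr (Or.inr (Or.inr (Or.inr (Or.inr (Or.inr
      (Or.inl rfl))))))))))
    ![s, t]
    (by simpa [-Term.subst] using ⟨h₁, h₂⟩)

theorem FactValid.isNonneg_congr (h₁ : FactValid T G R (eqTm s t))
    (h₂ : FactValid T G R (isNonneg s)) :
    FactValid T G R (isNonneg t) := by
  simpa [-Term.subst] using FactValid.of_axiom (G := G) (R := R)
    (hT.equality_subset (Or.inr (Or.inr (Or.inr (Or.inr (Or.inr (Or.inr (Or.inr (Or.inr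
      (Or.inr rfl))))))))))
    ![s, t]
    (by simpa [-Term.subst] using ⟨h₁, h₂⟩)

variable (T R s t) in
theorem factValid_add_comm : FactValid T G R (eqTm (s + t) (t + s)) := by
  simpa [-Term.subst] using FactValid.of_axiom (G := G) (R := R)
      (hT.ring_subset (Or.inl rfl)) ![s, t] (by simp)

variable (T R s t) in
theorem factValid_mul_comm : FactValid T G R (eqTm (s * t) (t * s)) := by
  simpa [-Term.subst] using FactValid.of_axiom (G := G) (R := R)
      (hT.ring_subset (Or.inr (Or.inr (Or.inr (Or.inr (Or.inl rfl)))))) ![s, t] (by simp)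

end Facts

variable (T R) [hT : RingTheory T]

/-- Equality of terms, as far as it is valid in `((G, R), T)`. -/
def termSetoid : Setoid ((latLang b).Term G) where
  r s t := FactValid T G R (eqTm s t)
  iseqv := ⟨fun s => factValid_refl T R s, FactValid.symm, FactValid.trans⟩

/-- The commutative ring of the terms of `((G, R), T)`, modulo valid equality. -/
def TermRing := Quotient (termSetoid T R)

namespace TermRing

/-- The class of a term. -/
def mk (s : (latLang b).Term G) : TermRing T R := Quotient.mk (termSetoid T R) s

variable {T R}

theorem mk_eq_mk : mk T R s = mk T R t ↔ FactValid T G R (eqTm s t) :=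
  ⟨fun h => Quotient.exact h, fun h => Quotient.sound (s := termSetoid T R) h⟩

theorem mk_surjective : Function.Surjective (mk T R) := Quotient.mk_surjective

instance : Zero (TermRing T R) := ⟨mk T R 0⟩
instance : One (TermRing T R) := ⟨mk T R 1⟩
instance : Neg (TermRing T R) :=
  ⟨Quotient.map (sa := termSetoid T R) (sb := termSetoid T R) (-·) fun _ _ h => h.neg_congr⟩
instance : Add (TermRing T R) :=
  ⟨Quotient.map₂ (sa := termSetoid T R) (sb := termSetoid T R) (sc := termSetoid T R) (· + ·)
    fun _ _ h _ _ h' => h.add_congr_left.trans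
      ((factValid_add_comm ..).trans (h'.add_congr_left.trans (factValid_add_comm ..)))⟩
instance : Mul (TermRing T R) :=
  ⟨Quotient.map₂ (sa := termSetoid T R) (sb := termSetoid T R) (sc := termSetoid T R) (· * ·)
    fun _ _ h _ _ h' => h.mul_congr_left.trans
      ((factValid_mul_comm ..).trans (h'.mul_congr_left.trans (factValid_mul_comm ..)))⟩
instance : Max (TermRing T R) :=
  ⟨Quotient.map₂ (sa := termSetoid T R) (sb := termSetoid T R) (sc := termSetoid T R) (· ⊔ ·)
    fun _ _ h _ _ h' => h.sup_congr_left.trans h'.sup_congr_right⟩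

@[simp] theorem mk_zero : mk T R 0 = 0 := rfl
@[simp] theorem mk_one : mk T R 1 = 1 := rfl
@[simp] theorem mk_neg : mk T R (-s) = -mk T R s := rfl
@[simp] theorem mk_add : mk T R (s + t) = mk T R s + mk T R t := rfl
@[simp] theorem mk_mul : mk T R (s * t) = mk T R s * mk T R t := rfl
@[simp] theorem mk_sup : mk T R (s ⊔ t) = mk T R s ⊔ mk T R t := rfl

theorem add_comm' (x y : TermRing T R) : x + y = y + x := by
  obtain ⟨s, rfl⟩ := mk_surjective x
  obtain ⟨t, rfl⟩ := mk_surjective y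
  exact mk_eq_mk.2 (factValid_add_comm ..)

theorem mul_comm' (x y : TermRing T R) : x * y = y * x := by
  obtain ⟨s, rfl⟩ := mk_surjective x
  obtain ⟨t, rfl⟩ := mk_surjective y
  exact mk_eq_mk.2 (factValid_mul_comm ..)

theorem add_assoc' (x y z : TermRing T R) : x + y + z = x + (y + z) := by
  obtain ⟨s, rfl⟩ := mk_surjective x
  obtain ⟨t, rfl⟩ := mk_surjective y
  obtain ⟨r, rfl⟩ := mk_surjective z
  refine mk_eq_mk.2 ?_
  simpa [-Term.subst] using FactValid.of_axiom (G := G) (R := R)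
      (hT.ring_subset (Or.inr (Or.inl rfl))) ![s, t, r] (by simp)

theorem mul_assoc' (x y z : TermRing T R) : x * y * z = x * (y * z) := by
  obtain ⟨s, rfl⟩ := mk_surjective x
  obtain ⟨t, rfl⟩ := mk_surjective y
  obtain ⟨r, rfl⟩ := mk_surjective z
  refine mk_eq_mk.2 ?_
  simpa [-Term.subst] using FactValid.of_axiom (G := G) (R := R)
      (hT.ring_subset (Or.inr (Or.inr (Or.inr (Or.inr (Or.inr (Or.inl rfl)))))))
      ![s, t, r] (by simp)

theorem mul_add' (x y z : TermRing T R) : x * (y + z) = x * y + x * z := by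
  obtain ⟨s, rfl⟩ := mk_surjective x
  obtain ⟨t, rfl⟩ := mk_surjective y
  obtain ⟨r, rfl⟩ := mk_surjective z
  refine mk_eq_mk.2 ?_
  simpa [-Term.subst] using FactValid.of_axiom (G := G) (R := R)
      (hT.ring_subset (Or.inr (Or.inr (Or.inr (Or.inr (Or.inr (Or.inr (Or.inr (Or.inl rfl)))))))))
      ![s, t, r] (by simp)

theorem add_zero' (x : TermRing T R) : x + 0 = x := by
  obtain ⟨s, rfl⟩ := mk_surjective x
  refine mk_eq_mk.2 ?_
  simpa [-Term.subst] using FactValid.of_axiom (G := G) (R := R)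
      (hT.ring_subset (Or.inr (Or.inr (Or.inl rfl)))) ![s] (by simp)

theorem mul_one' (x : TermRing T R) : x * 1 = x := by
  obtain ⟨s, rfl⟩ := mk_surjective x
  refine mk_eq_mk.2 ?_
  simpa [-Term.subst] using FactValid.of_axiom (G := G) (R := R)
      (hT.ring_subset (Or.inr (Or.inr (Or.inr (Or.inr (Or.inr (Or.inr (Or.inl rfl))))))))
      ![s] (by simp)

theorem add_neg' (x : TermRing T R) : x + -x = 0 := by
  obtain ⟨s, rfl⟩ := mk_surjective x
  refine mk_eq_mk.2 ?_
  simpa [-Term.subst] using FactValid.of_axiom (G := G) (R := R)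
      (hT.ring_subset (Or.inr (Or.inr (Or.inr (Or.inl rfl))))) ![s] (by simp)

instance : CommRing (TermRing T R) where
  add_comm := add_comm'
  add_assoc := add_assoc'
  zero_add x := by rw [add_comm', add_zero']
  add_zero := add_zero'
  neg_add_cancel x := by rw [add_comm', add_neg']
  mul_comm := mul_comm'
  mul_assoc := mul_assoc'
  one_mul x := by rw [mul_comm', mul_one']
  mul_one := mul_one'
  left_distrib := mul_add'
  right_distrib x y z := by rw [mul_comm', mul_add', mul_comm' z, mul_comm' z]
  zero_mul x := by
    have h : x * 0 + x * 0 = x * 0 := by rw [← mul_add', add_zero']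
    rw [mul_comm']
    calc x * 0 = x * 0 + x * 0 + -(x * 0) := by rw [add_assoc', add_neg', add_zero']
      _ = 0 := by rw [h, add_neg']
  mul_zero x := by
    have h : x * 0 + x * 0 = x * 0 := by rw [← mul_add', add_zero']
    calc x * 0 = x * 0 + x * 0 + -(x * 0) := by rw [add_assoc', add_neg', add_zero']
      _ = 0 := by rw [h, add_neg']
  nsmul := nsmulRec
  zsmul := zsmulRec

@[simp] theorem mk_sub : mk T R (s - t) = mk T R s - mk T R t := rfl

/-- Equality with 0 in the quotient unfolds to the fact s - 0 = 0, a different atomic formula from s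
= 0; the ring identity s = s - 0 connects them. -/
theorem mk_eq_zero : mk T R s = 0 ↔ FactValid T G R (isZero s) := by
  have h : FactValid T G R (eqTm s (s - 0)) := mk_eq_mk.1 (by simp)
  rw [← mk_zero, mk_eq_mk]
  exact ⟨fun h' => h.symm.isZero_congr h', fun h' => h.isZero_congr h'⟩

theorem isNonneg_iff_of_mk_eq (h : mk T R s = mk T R t) :
    FactValid T G R (isNonneg s) ↔ FactValid T G R (isNonneg t) :=
  ⟨(mk_eq_mk.1 h).isNonneg_congr, (mk_eq_mk.1 h.symm).isNonneg_congr⟩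

end TermRing

end TermRing

end Dynamical

namespace Dynamical

open FirstOrder FirstOrder.Language

/-! ## Strongly lattice-ordered rings: collapse and ordered fields -/

section Afr

instance : RingTheory Afr where
  equality_subset := fun _ h => Or.inl (Or.inl h)
  ring_subset := fun _ h => Or.inl (Or.inr h)

variable {G : Type w} {R : Set (Atom Sig G)}

open TermRing

theorem TermRing.afr_sup_idem (x : TermRing Afr R) : x ⊔ x = x := by
  obtain ⟨s, rfl⟩ := mk_surjective x
  refine mk_eq_mk.2 ?_
  simpa [-Term.subst] using FactValid.of_axiom (T := Afr) (G := G) (R := R)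
    (Or.inr (Or.inl rfl)) ![s]
    (by simp)

theorem TermRing.afr_sup_comm (x y : TermRing Afr R) : x ⊔ y = y ⊔ x := by
  obtain ⟨s, rfl⟩ := mk_surjective x
  obtain ⟨t, rfl⟩ := mk_surjective y
  refine mk_eq_mk.2 ?_
  simpa [-Term.subst] using FactValid.of_axiom (T := Afr) (G := G) (R := R)
    (Or.inr (Or.inr (Or.inl rfl))) ![s, t]
    (by simp)

theorem TermRing.afr_sup_assoc (x y z : TermRing Afr R) : x ⊔ y ⊔ z = x ⊔ (y ⊔ z) := by
  obtain ⟨s, rfl⟩ := mk_surjective x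
  obtain ⟨t, rfl⟩ := mk_surjective y
  obtain ⟨r, rfl⟩ := mk_surjective z
  refine mk_eq_mk.2 ?_
  simpa [-Term.subst] using FactValid.of_axiom (T := Afr) (G := G) (R := R)
    (Or.inr (Or.inr (Or.inr (Or.inl rfl)))) ![s, t, r]
    (by simp)

theorem TermRing.afr_add_sup (x y z : TermRing Afr R) : x + (y ⊔ z) = (x + y) ⊔ (x + z) := by
  obtain ⟨s, rfl⟩ := mk_surjective x
  obtain ⟨t, rfl⟩ := mk_surjective y
  obtain ⟨r, rfl⟩ := mk_surjective z
  refine mk_eq_mk.2 ?_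
  simpa [-Term.subst] using FactValid.of_axiom (T := Afr) (G := G) (R := R)
    (Or.inr (Or.inr (Or.inr (Or.inr (Or.inl rfl))))) ![s, t, r]
    (by simp)

theorem TermRing.afr_mul_sup (x y z : TermRing Afr R) :
    (x ⊔ 0) * (y ⊔ z) = (x ⊔ 0) * y ⊔ (x ⊔ 0) * z := by
  obtain ⟨s, rfl⟩ := mk_surjective x
  obtain ⟨t, rfl⟩ := mk_surjective y
  obtain ⟨r, rfl⟩ := mk_surjective z
  refine mk_eq_mk.2 ?_
  simpa [-Term.subst] using FactValid.of_axiom (T := Afr) (G := G) (R := R)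
    (Or.inr (Or.inr (Or.inr (Or.inr (Or.inr (Or.inl rfl)))))) ![s, t, r]
    (by simp)

theorem TermRing.afr_sup_zero {s : Sig.Term G} (h : FactValid Afr G R (isNonneg s)) :
    mk Afr R s ⊔ 0 = mk Afr R s := by
  refine mk_eq_mk.2 ?_
  simpa [-Term.subst] using FactValid.of_axiom (T := Afr) (G := G) (R := R)
    (Or.inr (Or.inr (Or.inr (Or.inr (Or.inr (Or.inr (Or.inl rfl))))))) ![s]
    (by simpa [-Term.subst] using h)

/-- If `((G, R), Afr)` does not collapse, the relations `R` are satisfied in a linearly ordered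
field. -/
theorem exists_orderedField_of_not_factValid_Afr (h : ¬ FactValid Afr G R (eqTm 1 0)) :
    ∃ (K : Type w) (_ : Field K) (_ : LinearOrder K) (_ : IsStrictOrderedRing K) (x : G → K),
      ∀ A ∈ R, A.Holds x := by
  have : Nontrivial (TermRing Afr R) := ⟨1, 0, fun h' => h (mk_eq_mk.1 h')⟩
  obtain ⟨K, i₁, i₂, i₃, f, hf⟩ := exists_ringHom_map_sup afr_sup_idem afr_sup_comm afr_sup_assoc
    afr_add_sup (afr_mul_sup (R := R))
  -- Since `f` preserves suprema as well as the ring operations, evaluating a term at the images of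
  -- the generators is the same as mapping its class.
  have hx : ∀ t : Sig.Term G, t.realize (fun g => f (mk Afr R (Term.var g))) = f (mk Afr R t) := by
    intro t
    induction t with
    | var => rfl
    | func g ts ih =>
      simp only [Term.realize, ih]
      cases g
      · have h : (Term.func FuncSym.zero ts : Sig.Term G) = 0 :=
          congrArg (Term.func _) (funext fun i => i.elim0)
        rw [h]
        exact (map_zero f).symm
      · have h : (Term.func FuncSym.one ts : Sig.Term G) = 1 :=
          congrArg (Term.func _) (funext fun i => i.elim0)
        rw [h]
        exact (map_one f).symm
      · have h : (Term.func FuncSym.neg ts : Sig.Term G) = -ts 0 :=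
          congrArg (Term.func _) (funext fun i => by fin_cases i; rfl)
        rw [h]
        exact (map_neg f _).symm
      · have h : (Term.func FuncSym.add ts : Sig.Term G) = ts 0 + ts 1 :=
          congrArg (Term.func _) (funext fun i => by fin_cases i <;> rfl)
        rw [h]
        exact (map_add f _ _).symm
      · have h : (Term.func FuncSym.mul ts : Sig.Term G) = ts 0 * ts 1 :=
          congrArg (Term.func _) (funext fun i => by fin_cases i <;> rfl)
        rw [h]
        exact (map_mul f _ _).symm
      · have h : (Term.func FuncSym.sup ts : Sig.Term G) = ts 0 ⊔ ts 1 :=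
          congrArg (Term.func _) (funext fun i => by fin_cases i <;> rfl)
        rw [h]
        exact (hf _ _).symm
  refine ⟨K, i₁, i₂, i₃, fun g => f (mk Afr R (Term.var g)), fun A hA => ?_⟩
  have hA' := FactValid.of_mem (T := Afr) hA
  obtain ⟨n, r, ts⟩ := A
  simp only [Atom.Holds, hx]
  cases r
  · have h : (⟨1, .eqZero false, ts⟩ : Atom Sig G) = isZero (ts 0) :=
      congrArg (Atom.mk 1 _) (funext fun i => by fin_cases i; rfl)
    rw [h] at hA'
    exact (congrArg f (mk_eq_zero.2 hA')).trans (map_zero f)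
  · have h : (⟨1, .nonneg false, ts⟩ : Atom Sig G) = isNonneg (ts 0) :=
      congrArg (Atom.mk 1 _) (funext fun i => by fin_cases i; rfl)
    rw [h] at hA'
    have := congrArg f (afr_sup_zero hA')
    rw [hf, map_zero] at this
    exact sup_eq_left.1 this

end Afr

/-! ## Discrete real closed fields with sup are strongly lattice-ordered rings -/

section Crcdsup

instance : RingTheory Crcdsup where
  equality_subset := fun _ h => Or.inl (Or.inl (Or.inl (Or.inl h)))
  ring_subset := fun _ h => Or.inl (Or.inl (Or.inl (Or.inr h)))

variable {G : Type w} {R : Set (Atom SigPos G)} {s t r : SigPos.Term G}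

open TermRing

theorem FactValid.isNonneg_of_isZero (h : FactValid Crcdsup G R (isZero s)) :
    FactValid Crcdsup G R (isNonneg s) := by
  simpa [-Term.subst] using FactValid.of_axiom (T := Crcdsup) (G := G) (R := R)
    (Or.inl (Or.inl (Or.inr (Or.inl rfl)))) ![s]
    (by simpa [-Term.subst] using h)

theorem FactValid.isNonneg_add (hs : FactValid Crcdsup G R (isNonneg s))
    (ht : FactValid Crcdsup G R (isNonneg t)) : FactValid Crcdsup G R (isNonneg (s + t)) := by
  simpa [-Term.subst] using FactValid.of_axiom (T := Crcdsup) (G := G) (R := R)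
    (Or.inl (Or.inl (Or.inr (Or.inr (Or.inl rfl))))) ![s, t]
    (by simpa [-Term.subst] using (And.intro hs ht))

theorem FactValid.isNonneg_mul (hs : FactValid Crcdsup G R (isNonneg s))
    (ht : FactValid Crcdsup G R (isNonneg t)) : FactValid Crcdsup G R (isNonneg (s * t)) := by
  simpa [-Term.subst] using FactValid.of_axiom (T := Crcdsup) (G := G) (R := R)
    (Or.inl (Or.inl (Or.inr (Or.inr (Or.inr (Or.inr (Or.inl rfl))))))) ![s, t]
    (by simpa [-Term.subst] using (And.intro hs ht))

theorem FactValid.isZero_of_isNonneg (hs : FactValid Crcdsup G R (isNonneg s))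
    (ht : FactValid Crcdsup G R (geTm 0 s)) : FactValid Crcdsup G R (isZero s) := by
  simpa [-Term.subst] using FactValid.of_axiom (T := Crcdsup) (G := G) (R := R)
    (Or.inl (Or.inl (Or.inr (Or.inr (Or.inr (Or.inr (Or.inr (Or.inr (Or.inr (Or.inr
      (Or.inr (Or.inr (Or.inr (Or.inl rfl))))))))))))))
    ![s]
    (by simpa [-Term.subst] using (And.intro hs ht))

variable (R s t) in
theorem factValid_sup_ge_left : FactValid Crcdsup G R (geTm (s ⊔ t) s) := by
  simpa [-Term.subst] using FactValid.of_axiom (T := Crcdsup) (G := G) (R := R)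
    (Or.inr (Or.inl rfl)) ![s, t]
    (by simp)

variable (R s t) in
theorem factValid_sup_ge_right : FactValid Crcdsup G R (geTm (s ⊔ t) t) := by
  simpa [-Term.subst] using FactValid.of_axiom (T := Crcdsup) (G := G) (R := R)
    (Or.inr (Or.inr (Or.inl rfl))) ![s, t]
    (by simp)

theorem FactValid.ge_sup (hs : FactValid Crcdsup G R (geTm r s))
    (ht : FactValid Crcdsup G R (geTm r t)) : FactValid Crcdsup G R (geTm r (s ⊔ t)) := by
  simpa [-Term.subst] using FactValid.of_axiom (T := Crcdsup) (G := G) (R := R)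
    (Or.inr (Or.inr (Or.inr rfl))) ![s, t, r]
    (by simpa [-Term.subst] using (And.intro hs ht))

variable (s t) in
theorem FactValid.of_total {A : Atom SigPos G}
    (h₁ : FactValid Crcdsup G (insert (isNonneg (s - t)) R) A)
    (h₂ : FactValid Crcdsup G (insert (geTm 0 (s - t)) R) A) : FactValid Crcdsup G R A := by
  refine FactValid.cases (T := Crcdsup) (Δ := [isNonneg (Term.var 0), geTm 0 (Term.var 0)])
    (Or.inl (Or.inl (Or.inr (Or.inr (Or.inr (Or.inr (Or.inr (Or.inr (Or.inr (Or.inr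
      (Or.inr (Or.inr (Or.inr (Or.inr (Or.inr (Or.inr (Or.inl rfl)))))))))))))))))
    ![s - t] ?_
  simpa [-Term.subst] using And.intro h₁ h₂

/-- The order of the ring of terms. -/
instance : LE (TermRing Crcdsup R) :=
  ⟨fun x y => ∃ s, mk Crcdsup R s = y - x ∧ FactValid Crcdsup G R (isNonneg s)⟩

/-! ### Order and suprema in the term ring of `Crcdsup` -/

namespace TermRing

theorem le_iff {x y : TermRing Crcdsup R} (h : mk Crcdsup R s = y - x) :
    x ≤ y ↔ FactValid Crcdsup G R (isNonneg s) :=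
  ⟨fun ⟨_, ht, ht'⟩ => (isNonneg_iff_of_mk_eq (ht.trans h.symm)).1 ht', fun hs => ⟨s, h, hs⟩⟩

theorem mk_le_mk : mk Crcdsup R s ≤ mk Crcdsup R t ↔ FactValid Crcdsup G R (geTm t s) :=
  le_iff (mk_sub ..)

theorem zero_le_mk : 0 ≤ mk Crcdsup R s ↔ FactValid Crcdsup G R (isNonneg s) :=
  le_iff (sub_zero _).symm

instance : PartialOrder (TermRing Crcdsup R) where
  le_refl x := ⟨0, by simp, FactValid.isNonneg_of_isZero (mk_eq_zero.1 mk_zero)⟩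
  le_trans := by
    rintro x y z ⟨s, hs, hs'⟩ ⟨t, ht, ht'⟩
    exact ⟨s + t, by rw [mk_add, hs, ht]; ring, hs'.isNonneg_add ht'⟩
  le_antisymm := by
    rintro x y ⟨s, hs, hs'⟩ ⟨t, ht, ht'⟩
    have h : mk Crcdsup R t = mk Crcdsup R (0 - s) := by simp [hs, ht]
    have := mk_eq_zero.2 (hs'.isZero_of_isNonneg ((isNonneg_iff_of_mk_eq h).1 ht'))
    rw [hs] at this
    exact (sub_eq_zero.1 this).symm

instance : IsOrderedAddMonoid (TermRing Crcdsup R) where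
  add_le_add_left := by
    rintro x y ⟨s, hs, hs'⟩ z
    exact ⟨s, by rw [hs]; ring, hs'⟩

theorem crcdsup_mul_nonneg {x y : TermRing Crcdsup R} (hx : 0 ≤ x) (hy : 0 ≤ y) : 0 ≤ x * y := by
  obtain ⟨s, rfl⟩ := mk_surjective x
  obtain ⟨t, rfl⟩ := mk_surjective y
  exact zero_le_mk.2 ((zero_le_mk.1 hx).isNonneg_mul (zero_le_mk.1 hy))

instance : SemilatticeSup (TermRing Crcdsup R) where
  sup := (· ⊔ ·)
  le_sup_left x y := by
    obtain ⟨s, rfl⟩ := mk_surjective x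
    obtain ⟨t, rfl⟩ := mk_surjective y
    exact mk_le_mk.2 (factValid_sup_ge_left ..)
  le_sup_right x y := by
    obtain ⟨s, rfl⟩ := mk_surjective x
    obtain ⟨t, rfl⟩ := mk_surjective y
    exact mk_le_mk.2 (factValid_sup_ge_right ..)
  sup_le x y z hxz hyz := by
    obtain ⟨s, rfl⟩ := mk_surjective x
    obtain ⟨t, rfl⟩ := mk_surjective y
    obtain ⟨r, rfl⟩ := mk_surjective z
    exact mk_le_mk.2 ((mk_le_mk.1 hxz).ge_sup (mk_le_mk.1 hyz))

/-- Translations are order automorphisms, so they preserve least upper bounds. -/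
theorem crcdsup_add_sup (x y z : TermRing Crcdsup R) : x + (y ⊔ z) = (x + y) ⊔ (x + z) := by
  refine le_antisymm ?_ (sup_le (add_le_add_right le_sup_left x) (add_le_add_right le_sup_right x))
  rw [← le_sub_iff_add_le']
  exact sup_le (le_sub_iff_add_le'.2 le_sup_left) (le_sub_iff_add_le'.2 le_sup_right)

theorem crcdsup_mul_sup {x y : TermRing Crcdsup R} (hxy : x ≤ y) (z : TermRing Crcdsup R) :
    (z ⊔ 0) * (x ⊔ y) = (z ⊔ 0) * x ⊔ (z ⊔ 0) * y := by
  have := crcdsup_mul_nonneg (le_sup_right : 0 ≤ z ⊔ 0) (sub_nonneg.2 hxy)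
  rw [mul_sub, sub_nonneg] at this
  have h₁ : x ⊔ y = y := sup_eq_right.2 hxy
  have h₂ : (z ⊔ 0) * x ⊔ (z ⊔ 0) * y = (z ⊔ 0) * y := sup_eq_right.2 this
  rw [h₁, h₂]

end TermRing

/-- The one axiom of `Afr` for which totality of the order is invoked. The term ring need not be
totally ordered, so the dynamical proof branches on the sign of t - r; each branch is computed in
the term ring with that fact added, where t and r are comparable. -/
theorem factValid_mul_sup (s t r : SigPos.Term G) :
    FactValid Crcdsup G R (eqTm ((s ⊔ 0) * (t ⊔ r)) (((s ⊔ 0) * t) ⊔ ((s ⊔ 0) * r))) := by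
  refine FactValid.of_total t r (mk_eq_mk.1 ?_) (mk_eq_mk.1 ?_)
  · have h : mk Crcdsup (insert (isNonneg (t - r)) R) r ≤ mk _ _ t :=
      mk_le_mk.2 (FactValid.of_mem (Set.mem_insert _ _))
    exact ((congrArg _ (sup_comm _ _)).trans (crcdsup_mul_sup h (mk _ _ s))).trans (sup_comm _ _)
  · have h : FactValid Crcdsup G (insert (geTm 0 (t - r)) R) (geTm 0 (t - r)) :=
      FactValid.of_mem (Set.mem_insert _ _)
    have hle : mk Crcdsup (insert (geTm 0 (t - r)) R) t ≤ mk _ _ r :=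
      (le_iff (s := 0 - (t - r)) (by simp)).2 h
    exact crcdsup_mul_sup hle (mk _ _ s)

theorem onTerm_var {L : FirstOrder.Language} {L' : FirstOrder.Language} {α : Type*} (φ : L →ᴸ L')
    (a : α) : φ.onTerm (Term.var a : L.Term α) = Term.var a := rfl

theorem valid_algRule_onRule {n : ℕ} {p : List (Atom Sig (Fin n)) × Atom Sig (Fin n)}
    (h : FactValid Crcdsup (Fin n) {A | A ∈ p.1.map (Atom.onAtom sigIncl)}
      (p.2.onAtom sigIncl)) : Valid Crcdsup ((algRule n p).onRule sigIncl) := by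
  rw [FactValid, ← Atom.onAtom_relabel] at h
  exact h

/-- Apart from the equality rules and `factValid_mul_sup`, the axioms are read in the term ring of
`Crcdsup` whose relations are the hypotheses of the rule. There they are statements about
commutative rings and ordered groups with suprema. -/
theorem extends_sigIncl : Extends sigIncl Afr Crcdsup := by
  rintro r ((hr | hr) | hr)
  · simp only [equalityAxioms, Set.mem_insert_iff, Set.mem_singleton_iff] at hr
    rcases hr with rfl | rfl | rfl | rfl | rfl | rfl | rfl | rfl | rfl | rfl <;>
      refine valid_algRule_onRule ?_ <;> simp [-LHom.onTerm, onTerm_var]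
    · exact factValid_refl ..
    · exact (FactValid.of_mem (T := Crcdsup) (Set.mem_singleton _)).symm
    · exact (FactValid.of_mem (T := Crcdsup) (Or.inl rfl)).trans (FactValid.of_mem (Or.inr rfl))
    · exact (FactValid.of_mem (T := Crcdsup) (Set.mem_singleton _)).neg_congr
    · exact (FactValid.of_mem (T := Crcdsup) (Set.mem_singleton _)).add_congr_left
    · exact (FactValid.of_mem (T := Crcdsup) (Set.mem_singleton _)).mul_congr_left
    · exact (FactValid.of_mem (T := Crcdsup) (Set.mem_singleton _)).sup_congr_left
    · exact (FactValid.of_mem (T := Crcdsup) (Set.mem_singleton _)).sup_congr_right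
    · exact (FactValid.of_mem (Or.inl rfl)).isZero_congr (FactValid.of_mem (Or.inr rfl))
    · exact (FactValid.of_mem (Or.inl rfl)).isNonneg_congr (FactValid.of_mem (Or.inr rfl))
  · simp only [ringAxioms, Set.mem_insert_iff, Set.mem_singleton_iff] at hr
    rcases hr with rfl | rfl | rfl | rfl | rfl | rfl | rfl | rfl | rfl | rfl | rfl <;>
      refine valid_algRule_onRule ?_ <;> simp [-LHom.onTerm, onTerm_var, ← mk_eq_mk, ← mk_eq_zero]
    · exact add_comm _ _
    · exact add_assoc _ _ _
    · exact mul_comm _ _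
    · exact mul_assoc _ _ _
    · exact mul_add _ _ _
    · rw [mk_eq_zero.2 (FactValid.of_mem (Or.inl rfl)),
        mk_eq_zero.2 (FactValid.of_mem (Or.inr rfl)), add_zero]
    · rw [mk_eq_zero.2 (FactValid.of_mem (Set.mem_singleton _)), zero_mul]
  · simp only [Set.mem_insert_iff, Set.mem_singleton_iff] at hr
    rcases hr with rfl | rfl | rfl | rfl | rfl | rfl | rfl <;>
      refine valid_algRule_onRule ?_ <;> simp [-LHom.onTerm, onTerm_var]
    · exact mk_eq_mk.1 (sup_idem (mk Crcdsup _ _))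
    · exact mk_eq_mk.1 (sup_comm (mk Crcdsup _ _) (mk Crcdsup _ _))
    · exact mk_eq_mk.1 (sup_assoc (mk Crcdsup _ _) (mk Crcdsup _ _) (mk Crcdsup _ _))
    · exact mk_eq_mk.1 (crcdsup_add_sup (mk Crcdsup _ _) (mk Crcdsup _ _) (mk Crcdsup _ _))
    · exact factValid_mul_sup _ _ _
    · refine mk_eq_mk.1 (?_ : mk Crcdsup _ _ ⊔ 0 = _)
      exact sup_eq_left.2 (zero_le_mk.2 (FactValid.of_mem rfl))
    · refine zero_le_mk.1 (sup_eq_left.1 ?_)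
      exact mk_eq_mk.2 (FactValid.of_mem rfl)

end Crcdsup

/-! ## Simultaneous collapse -/

section Collapse

instance sigIncl_isExpansionOn (K : Type*) [CommRing K] [LinearOrder K] :
    sigIncl.IsExpansionOn K where
  map_onFunction f _ := by cases f <;> rfl
  map_onRelation R _ := by cases R <;> rfl

theorem Atom.holds_onAtom {L : FirstOrder.Language.{u, v}} {L' : FirstOrder.Language.{u', v'}}
    {α M : Type*} [L.Structure M] [L'.Structure M] (φ : L →ᴸ L') [φ.IsExpansionOn M]
    (A : Atom L α) (x : α → M) : (A.onAtom φ).Holds x ↔ A.Holds x := by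
  simp only [Atom.Holds, Atom.onAtom, LHom.realize_onTerm]
  rw [LHom.map_onRelation]

theorem collapses_id_iff {G : Type w} {R : Set (Atom Sig G)} :
    Collapses (LHom.id Sig) Afr G R ↔ FactValid Afr G R (eqTm 1 0) := by
  have h : (Atom.onAtom (LHom.id Sig) : Atom Sig G → Atom Sig G) = id := funext Atom.onAtom_id
  rw [Collapses, h, Set.image_id, id]

/-- The only direction that leaves syntax: without a collapse in `Afr`, the relations have a
solution in an ordered field, and this solution forbids a collapse in `Crcdsup`. -/
theorem collapses_Afr_of_collapses_Crcdsup {G : Type w} {R : Set (Atom Sig G)}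
    (h : Collapses sigIncl Crcdsup G R) : Collapses (LHom.id Sig) Afr G R := by
  rw [collapses_id_iff]
  by_contra hA
  obtain ⟨K, _, _, _, x, hx⟩ := exists_orderedField_of_not_factValid_Afr hA
  rw [Collapses, sigIncl_eqTm, sigIncl_one, sigIncl_zero] at h
  refine not_factValid_Crcdsup x ?_ h
  rintro _ ⟨A, hA, rfl⟩
  exact (A.holds_onAtom sigIncl x).2 (hx A hA)

theorem collapses_of_extends {L : FirstOrder.Language.{u, v}} {ι : Sig →ᴸ L} {T : DynTheory L}
    (hT : Extends ι Afr T) {G : Type w} {R : Set (Atom Sig G)}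
    (h : Collapses (LHom.id Sig) Afr G R) : Collapses ι T G R :=
  (collapses_id_iff.1 h).translate hT

theorem IsIntermediate.collapses_Crcdsup {L : FirstOrder.Language.{u, v}} {ι : Sig →ᴸ L}
    {T : DynTheory L} (hT : IsIntermediate.{u, v, u', v'} ι T) {G : Type w} {R : Set (Atom Sig G)}
    (h : Collapses ι T G R) : Collapses sigIncl Crcdsup G R := by
  obtain ⟨-, L', U, j, k, hjk, hU, hk⟩ := hT
  have h' := FactValid.translate hU h
  -- Both routes from `Sig` to `L'` agree, so the translated presentation also comes from `SigPos`,
  -- where conservativity applies.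
  simp only [Set.image_image, ← Atom.onAtom_comp, hjk] at h'
  simp only [Atom.onAtom_comp] at h'
  rw [← Set.image_image (Atom.onAtom k), sigIncl_eqTm, sigIncl_one, sigIncl_zero,
    ← one_eq_zero_relabel Empty.elim] at h'
  -- The constant 0 is the closed term given to the generators that the proof does not use.
  have := hk.factValid 0 h'
  rwa [one_eq_zero_relabel, ← sigIncl_one, ← sigIncl_zero, ← sigIncl_eqTm] at this

end Collapse

end Dynamical

theorem mainTheorem4 :
    -- `Crcdsup` extends `Afr`, and these two theories collapse simultaneously
    Dynamical.Extends Dynamical.sigIncl Dynamical.Afr Dynamical.Crcdsup ∧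
    Dynamical.CollapseSimultaneously.{0, 0, 0, 0, w}
      (FirstOrder.Language.LHom.id Dynamical.Sig) Dynamical.Afr
      Dynamical.sigIncl Dynamical.Crcdsup ∧
    -- each intermediate theory collapses simultaneously with both of them
    ∀ (L : FirstOrder.Language.{u, v}) (ι : Dynamical.Sig →ᴸ L) (T : Dynamical.DynTheory L),
      Dynamical.IsIntermediate.{u, v, u', v'} ι T →
        Dynamical.CollapseSimultaneously.{0, 0, u, v, w}
          (FirstOrder.Language.LHom.id Dynamical.Sig) Dynamical.Afr ι T ∧
        Dynamical.CollapseSimultaneously.{u, v, 0, 0, w}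
          ι T Dynamical.sigIncl Dynamical.Crcdsup :=
  ⟨Dynamical.extends_sigIncl,
    fun _ _ => ⟨Dynamical.collapses_of_extends Dynamical.extends_sigIncl,
      Dynamical.collapses_Afr_of_collapses_Crcdsup⟩,
    fun _ _ _ hT =>
      ⟨fun _ _ => ⟨Dynamical.collapses_of_extends hT.1, fun h =>
        Dynamical.collapses_Afr_of_collapses_Crcdsup (hT.collapses_Crcdsup h)⟩,
      fun _ _ => ⟨hT.collapses_Crcdsup, fun h => Dynamical.collapses_of_extends hT.1
        (Dynamical.collapses_Afr_of_collapses_Crcdsup h)⟩⟩⟩
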